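/- Let $\mathbb K$ be a field and let $K_0(\mathcal V_{\mathbb K})$ be the Grothendieck ring of varieties over $\mathbb K$: the abelian group generated by the isomorphism classes $[X]$ of varieties (separated schemes of finite type over $\mathbb K$), modulo the relations $[X]=[Z]+[X\smallsetminus Z]$ for closed subvarieties $Z\subset X$, with product $[X]\cdot[Y]=[X\times Y]$. Let $\mathbb L=[\mathbb A^1]$. A class is called Tate if it lies in the subring of $K_0(\mathcal V_{\mathbb K})$ generated by $\mathbb L$. For a finite multigraph $G$ with $n$ edges let $\Psi_G=\sum_{T}\prod_{e\notin E(T)}t_e$ (the sum over the spanning trees $T$ of $G$) be its Kirchhoff--Symanzik polynomial, let $\hat X_G\subset\mathbb A^n$ be the affine cone over the graph hypersurface, i.e. the zero locus of $\Psi_G$ in the affine space with coordinates $t_e$, and let $\mathbb U(G)=[\mathbb A^n\smallsetminus\hat X_G]\in K_0(\mathcal V_{\mathbb K})$ be the Grothendieck class of $G$. A melonic construction is a list $(t_1,\dots,t_N)$ of tuples $t_s=(b_s,p_s,k_s)$ where $b_s=(a_1,\dots,a_{r_s})$ is a nonempty tuple of positive integers, $0\le p_s<s$, $p_s>0$ for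 $s>1$, $1\le k_s\le |b_{p_s}|$ (with $b_0=(1)$), and, for all $i\ge1$ and $j$, at most $a_j$ tuples $t_s$ have $p_s=i$, $k_s=j$, where $a_j$ is the $j$-th entry of $b_i$. It determines a multigraph: start from a single edge, which is the only banana of stage $0$; at stage $s$, replace one edge of the $k_s$-th banana constructed at stage $p_s$ by a string of $r_s$ bananas, the $j$-th of which consists of $a_j$ parallel edges. A melonic graph is a graph isomorphic to one determined by a melonic construction. Let $G$ be a melonic graph with $n$ edges. Then there is a polynomial $P\in\mathbb Z[x]$ of degree exactly $n$ such that $\mathbb U(G)=P(\mathbb L)$. In particular the class $\mathbb U(G)$ is Tate, and so is the class $[\hat X_G]$ of the affine cone over the graph hypersurface of $G$. -/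

import Mathlib

universe u v

open CategoryTheory MonoidalCategory AlgebraicGeometry Polynomial

noncomputable section

/-! ### The Grothendieck ring of varieties -/

/-- The property of a `K`-scheme of being a variety: separated and of finite type over `K`. -/
def isVariety (K : Type u) [Field K] : ObjectProperty (Over (Spec (CommRingCat.of K))) :=
  fun X => LocallyOfFiniteType X.hom ∧ QuasiCompact X.hom ∧ IsSeparated X.hom

instance isVariety_isMonoidal (K : Type u) [Field K] : (isVariety K).IsMonoidal where
  prop_unit := by
    change LocallyOfFiniteType (𝟙 (Spec (CommRingCat.of K))) ∧
      QuasiCompact (𝟙 (Spec (CommRingCat.of K))) ∧ IsSeparated (𝟙 (Spec (CommRingCat.of K)))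
    exact ⟨inferInstance, inferInstance, inferInstance⟩
  prop_tensor X Y := by
    rintro ⟨h1, h2, h3⟩ ⟨h4, h5, h6⟩
    refine ⟨?_, ?_, ?_⟩ <;> (rw [Over.tensorObj_hom]; infer_instance)

/-- The category of varieties over `K`, with the `K`-morphisms; the tensor product is the
fibre product over `K`. -/
abbrev Variety (K : Type u) [Field K] : Type (u + 1) := (isVariety K).FullSubcategory

/-- The commutative monoid of isomorphism classes of varieties over `K`, under the product. -/
abbrev VarietyClass (K : Type u) [Field K] : Type (u + 1) := Skeleton (Variety K)

/-- The generator of the free abelian group on isomorphism classes of varieties that is given by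
the isomorphism class of `X`. -/
def freeClass {K : Type u} [Field K] (X : Variety K) : MonoidAlgebra ℤ (VarietyClass K) :=
  MonoidAlgebra.of ℤ (VarietyClass K) (toSkeleton X)

/-- The elements `[X] - [Z] - [U]` for a variety `X`, a closed subvariety `Z` of `X` and its
open complement `U`. -/
def scissorRelations (K : Type u) [Field K] : Set (MonoidAlgebra ℤ (VarietyClass K)) :=
  {x | ∃ (X Z U : Variety K) (i : Z ⟶ X) (j : U ⟶ X),
    IsClosedImmersion i.hom.left ∧ IsOpenImmersion j.hom.left ∧
    IsCompl (Set.range i.hom.left) (Set.range j.hom.left) ∧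
    x = freeClass X - freeClass Z - freeClass U}

/-- The Grothendieck ring of varieties over `K`: the free abelian group on the isomorphism classes
of varieties, with the product `[X] * [Y] = [X × Y]`, modulo the scissor relations. (The product
of a scissor relation with a class `[Y]` is again a scissor relation, so the subgroup and the ideal
that these relations generate are the same.) -/
abbrev GrothendieckRing (K : Type u) [Field K] : Type (u + 1) :=
  MonoidAlgebra ℤ (VarietyClass K) ⧸ Ideal.span (scissorRelations K)

/-- The class `[X]` of a variety in the Grothendieck ring. -/
def varietyClass {K : Type u} [Field K] (X : Variety K) : GrothendieckRing K :=
  Ideal.Quotient.mk _ (freeClass X)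

/-- The spectrum of a finitely generated `K`-algebra, as a variety. -/
def specVariety (K : Type u) [Field K] (A : Type u) [CommRing A] [Algebra K A]
    [Algebra.FiniteType K A] : Variety K where
  obj := Over.mk (Spec.map (CommRingCat.ofHom (algebraMap K A)))
  property := by
    change LocallyOfFiniteType (Spec.map (CommRingCat.ofHom (algebraMap K A))) ∧
      QuasiCompact (Spec.map (CommRingCat.ofHom (algebraMap K A))) ∧
      IsSeparated (Spec.map (CommRingCat.ofHom (algebraMap K A)))
    refine ⟨?_, inferInstance, inferInstance⟩
    rw [HasRingHomProperty.Spec_iff (P := @LocallyOfFiniteType), CommRingCat.hom_ofHom,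
      RingHom.finiteType_algebraMap]
    infer_instance

/-- An open subscheme of the spectrum of a finitely generated `K`-algebra, as a variety. -/
def openVariety (K : Type u) [Field K] {A : Type u} [CommRing A] [Algebra K A]
    [Algebra.FiniteType K A] (V : (Spec (CommRingCat.of A)).Opens) : Variety K where
  obj := Over.mk (V.ι ≫ Spec.map (CommRingCat.ofHom (algebraMap K A)))
  property := by
    have : IsNoetherianRing A := Algebra.FiniteType.isNoetherianRing K A
    have : LocallyOfFiniteType (Spec.map (CommRingCat.ofHom (algebraMap K A))) :=
      (specVariety K A).property.1
    change LocallyOfFiniteType (V.ι ≫ Spec.map (CommRingCat.ofHom (algebraMap K A))) ∧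
      QuasiCompact (V.ι ≫ Spec.map (CommRingCat.ofHom (algebraMap K A))) ∧
      IsSeparated (V.ι ≫ Spec.map (CommRingCat.ofHom (algebraMap K A)))
    exact ⟨inferInstance, inferInstance, inferInstance⟩

/-- The class `𝕃 = [𝔸¹]` of the affine line. -/
def lefschetz (K : Type u) [Field K] : GrothendieckRing K := varietyClass (specVariety K K[X])

/-- A class in the Grothendieck ring is Tate if it lies in the subring generated by `𝕃`. -/
def IsTateClass {K : Type u} [Field K] (x : GrothendieckRing K) : Prop :=
  x ∈ Subring.closure {lefschetz K}

/-! ### The graph hypersurface -/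

namespace Graph

/-- Two vertices are joined by a path all of whose edges lie in `F`. -/
def JoinedBy {α : Type v} {β : Type u} (G : Graph α β) (F : Set β) (x y : α) : Prop :=
  Relation.ReflTransGen (fun a b => ∃ e ∈ F, G.IsLink e a b) x y

/-- `F` is the edge set of a spanning tree of `G`: the subgraph with all the vertices of `G` and
the edges `F` is nonempty, connected, and acyclic (no edge `e` of `F` lies on a cycle, that is, the
ends of `e` are not joined by the other edges of `F`). -/
def IsSpanningTree {α : Type v} {β : Type u} (G : Graph α β) (F : Set β) : Prop :=
  F ⊆ G.edgeSet ∧ G.vertexSet.Nonempty ∧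
  (∀ x ∈ G.vertexSet, ∀ y ∈ G.vertexSet, G.JoinedBy F x y) ∧
  ∀ e ∈ F, ∀ x y, G.IsLink e x y → ¬ G.JoinedBy (F \ {e}) x y

open Classical in
/-- The Kirchhoff–Symanzik polynomial `∑_T ∏_{e ∉ T} t_e`, the sum being over the spanning trees
`T` of `G`, in variables indexed by the edges of `G`. -/
def kirchhoff (K : Type u) [Field K] {α : Type v} {β : Type u} (G : Graph α β)
    [Fintype G.edgeSet] : MvPolynomial G.edgeSet K :=
  ∑ T ∈ (Finset.univ : Finset (Finset G.edgeSet)).filter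
      (fun T => G.IsSpanningTree {e | ∃ h : e ∈ G.edgeSet, ⟨e, h⟩ ∈ T}),
    ∏ e ∈ Tᶜ, MvPolynomial.X e

/-- The affine cone `X̂_G` over the graph hypersurface: the zero scheme of the Kirchhoff–Symanzik
polynomial in the affine space with coordinates indexed by the edges of `G`. -/
def affineHypersurface (K : Type u) [Field K] {α : Type v} {β : Type u} (G : Graph α β)
    [Fintype G.edgeSet] : Variety K :=
  specVariety K (MvPolynomial G.edgeSet K ⧸ Ideal.span {G.kirchhoff K})

/-- The complement of `X̂_G` in the affine space with coordinates indexed by the edges of `G`. -/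
def hypersurfaceComplement (K : Type u) [Field K] {α : Type v} {β : Type u} (G : Graph α β)
    [Fintype G.edgeSet] : Variety K :=
  openVariety K (A := MvPolynomial G.edgeSet K) (PrimeSpectrum.basicOpen (G.kirchhoff K))

/-- The Grothendieck class `𝕌(G)` of a graph. -/
def grothendieckClass (K : Type u) [Field K] {α : Type v} {β : Type u} (G : Graph α β)
    [Fintype G.edgeSet] : GrothendieckRing K :=
  varietyClass (G.hypersurfaceComplement K)

/-- `G` and `H` are isomorphic as multigraphs. -/
def IsIsomorphic {α α' β β' : Type*} (G : Graph α β) (H : Graph α' β') : Prop :=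
  ∃ (f : G.vertexSet ≃ H.vertexSet) (g : G.edgeSet ≃ H.edgeSet),
    ∀ (e : G.edgeSet) (x y : G.vertexSet), G.IsLink e x y ↔ H.IsLink (g e) (f x) (f y)

end Graph

end

/-! ### Melonic graphs -/

/-- A tuple `((a₁, …, a_r), p, k)`: one edge of the `k`-th banana constructed at stage `p` is
to be replaced by a string of bananas with `a₁, …, a_r` edges. -/
structure MelonicStage where
  bananas : List ℕ
  stage : ℕ
  index : ℕ

/-- The tuple of banana sizes constructed at stage `s` of `T = (t₁, …, t_n)`; at stage `0` this is
the initial single edge, a `1`-banana. -/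
def bananasAt (T : List MelonicStage) : ℕ → List ℕ
  | 0 => [1]
  | s + 1 => (T[s]?.map MelonicStage.bananas).getD []

/-- `T = (t₁, …, t_n)` is a melonic construction; `t_s = (b_s, p_s, k_s)` is `T[s - 1]`. -/
structure IsMelonicConstruction (T : List MelonicStage) : Prop where
  bananas_ne_nil : ∀ t ∈ T, t.bananas ≠ []
  bananas_pos : ∀ t ∈ T, ∀ a ∈ t.bananas, 0 < a
  stage_lt : ∀ s (hs : s < T.length), T[s].stage < s + 1
  one_le_index : ∀ t ∈ T, 1 ≤ t.index
  index_le : ∀ t ∈ T, t.index ≤ (bananasAt T t.stage).length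
  stage_pos : ∀ s (hs : s < T.length), 0 < s → 0 < T[s].stage
  /-- At most `a_j` tuples replace an edge of the `j`-th banana of stage `i`. -/
  count_le : ∀ i (hi : i < T.length) j (hj : j < T[i].bananas.length),
    T.countP (fun t => t.stage = i + 1 ∧ t.index = j + 1) ≤ T[i].bananas[j]

/-- An edge of a graph under construction, with vertices numbered by natural numbers, which belongs
to the `index`-th banana constructed at stage `stage`. -/
structure MelonicEdge where
  source : ℕ
  target : ℕ
  stage : ℕ
  index : ℕ

/-- The edges of a string of bananas of the given sizes from the vertex `u` to the vertex `w`,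
constructed at stage `s`. The bananas are numbered from `j` on, and the intermediate vertices
are `m, m + 1, …`. -/
def bananaString (s w : ℕ) : (u m j : ℕ) → List ℕ → List MelonicEdge
  | _, _, _, [] => []
  | u, _, j, [a] => List.replicate a ⟨u, w, s, j⟩
  | u, m, j, a :: b :: l =>
      List.replicate a ⟨u, m, s, j⟩ ++ bananaString s w m (m + 1) (j + 1) (b :: l)

/-- Replace the first edge in the list that belongs to the `k`-th banana of stage `p` by the
edges that `f` assigns to it. -/
def replaceEdge (p k : ℕ) (f : MelonicEdge → List MelonicEdge) :
    List MelonicEdge → List MelonicEdge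
  | [] => []
  | e :: l => if e.stage = p ∧ e.index = k then f e ++ l else e :: replaceEdge p k f l

/-- Carry out the stages `s, s + 1, …` of a melonic construction on a graph with edges `E` and with
vertices smaller than `m`. -/
def runMelonic : (s m : ℕ) → List MelonicStage → List MelonicEdge → List MelonicEdge
  | _, _, [], E => E
  | s, m, t :: T, E => runMelonic (s + 1) (m + (t.bananas.length - 1)) T
      (replaceEdge t.stage t.index
        (fun e => bananaString s e.target e.source m 1 t.bananas) E)

/-- The edges of the graph that a melonic construction determines: its stages are carried out on
a single edge with vertices `0` and `1`. -/
def melonicEdges (T : List MelonicStage) : List MelonicEdge :=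
  runMelonic 1 2 T [⟨0, 1, 0, 1⟩]

/-- The multigraph with a given list of edges; its vertices are the ends of the edges. -/
def graphOfEdges (E : List MelonicEdge) : Graph ℕ (Fin E.length) where
  vertexSet := {x | ∃ e ∈ E, x = e.source ∨ x = e.target}
  IsLink i x y := s(E[i].source, E[i].target) = s(x, y)
  isLink_symm i _ := ⟨fun x y h => h.trans Sym2.eq_swap⟩
  eq_or_eq_of_isLink_of_isLink i x y v w h h' := by
    have := Sym2.eq_iff.mp (h.symm.trans h')
    tauto
  left_mem_of_isLink i x y h := by
    refine ⟨E[i], List.getElem_mem _, ?_⟩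
    have := Sym2.eq_iff.mp h
    omega

/-- A melonic graph is a graph isomorphic to the one that some melonic construction determines. -/
def Graph.IsMelonic {α β : Type*} (G : Graph α β) : Prop :=
  ∃ T : List MelonicStage, IsMelonicConstruction T ∧ G.IsIsomorphic (graphOfEdges (melonicEdges T))

/-! ### Classes of affine varieties -/

section AffineClass

variable {K : Type u} [Field K]

/-! Read the variables `t_e` as resistances. For a network with terminals `s` and `t`, let `Ψ` be
the Kirchhoff polynomial and let `Φ` be the analogous sum over the spanning forests with two
components that separate `s` from `t`. The ratio `Φ / Ψ` is the effective resistance. It adds under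
series composition, its inverse adds under parallel composition, and it has weight one when all
variables are scaled. A melonic graph is a series-parallel network, because an edge is replaced by a
series of bundles of parallel edges.

The induction carries three classes: `a` of `{Φ = 0, Ψ ≠ 0}`, `b` of `{Ψ = 0, Φ ≠ 0}` and `f` of `{Φ
= Ψ ≠ 0}`. The locus where both vanish never enters. By scaling, `{Φ ≠ 0, Ψ ≠ 0}` is the product of
the multiplicative group and the fibre of ratio one (`Scales.hasClass_units`), so `{Ψ ≠ 0}` has
class `u = a + (𝕃 - 1) f`. A series composition has `Φ = Φ₁Ψ₂ + Ψ₁Φ₂` and `Ψ = Ψ₁Ψ₂`, and cutting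
its loci into pieces gives `a = a₁a₂ + (𝕃 - 1) f₁f₂`, `b = b₁u₂ + u₁b₂`, `f = a₁f₂ + f₁a₂ + (𝕃 - 2)
f₁f₂`. The factors `𝕃 - 1` and `𝕃 - 2` are the classes of pairs of nonzero resistances with sum `0`
and `1`. Parallel composition is the same with `Φ` and `Ψ` exchanged. With `n` edges, `a` and `b`
have degree less than `n` in `𝕃` and `f` is monic of degree `n - 1` (`IsTatePair.cross`), so `u`,
which is the class of the graph, is monic of degree `n`.

Loci are treated as functors of points, so that a class is transported along a natural bijection of
points (`HasClass.of_bijection`). Connectivity is expressed by cuts: `Ψ` and `Φ` come from the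
minimal members of `spanningFamily E {s}` and `spanningFamily E {s, t}`, and gluing cuts
(`exists_glue`) yields the series and parallel formulas. -/

theorem varietyClass_eq_of_iso {X Y : Variety K} (e : X ≅ Y) : varietyClass X = varietyClass Y := by
  have : toSkeleton X = toSkeleton Y := Quotient.sound ⟨e⟩
  rw [varietyClass, varietyClass, freeClass, freeClass, this]

theorem varietyClass_tensor (X Y : Variety K) :
    varietyClass (X ⊗ Y) = varietyClass X * varietyClass Y := by
  rw [varietyClass, varietyClass, varietyClass, freeClass, freeClass, freeClass,
    Skeleton.toSkeleton_tensorObj, map_mul, map_mul]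

theorem varietyClass_unit : varietyClass (𝟙_ (Variety K)) = 1 := by
  rw [varietyClass, freeClass]
  change Ideal.Quotient.mk _ (MonoidAlgebra.of ℤ (VarietyClass K) 1) = 1
  rw [map_one, map_one]

theorem varietyClass_eq_add {X Z U : Variety K} (i : Z ⟶ X) (j : U ⟶ X)
    (hi : IsClosedImmersion i.hom.left) (hj : IsOpenImmersion j.hom.left)
    (h : IsCompl (Set.range i.hom.left) (Set.range j.hom.left)) :
    varietyClass X = varietyClass Z + varietyClass U := by
  rw [← sub_eq_zero, ← sub_sub]
  simp only [varietyClass, ← map_sub]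
  exact Ideal.Quotient.eq_zero_iff_mem.mpr (Ideal.subset_span ⟨X, Z, U, i, j, hi, hj, h, rfl⟩)

variable {A B : Type u} [CommRing A] [Algebra K A] [Algebra.FiniteType K A]
  [CommRing B] [Algebra K B] [Algebra.FiniteType K B]

/-- The morphism of affine varieties given by a homomorphism of algebras. -/
noncomputable def specVarietyMap (φ : A →ₐ[K] B) : specVariety K B ⟶ specVariety K A :=
  ObjectProperty.homMk (Over.homMk (Spec.map (CommRingCat.ofHom φ.toRingHom)) (by
    change Spec.map _ ≫ Spec.map _ = Spec.map _
    rw [← Spec.map_comp, ← CommRingCat.ofHom_comp]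
    congr 2
    exact φ.comp_algebraMap))

theorem specVarietyMap_left (φ : A →ₐ[K] B) :
    (specVarietyMap φ).hom.left = Spec.map (CommRingCat.ofHom φ.toRingHom) := rfl

theorem varietyClass_specVariety_congr (e : A ≃ₐ[K] B) :
    varietyClass (specVariety K A) = varietyClass (specVariety K B) := by
  refine varietyClass_eq_of_iso ⟨specVarietyMap e.symm.toAlgHom, specVarietyMap e.toAlgHom, ?_, ?_⟩
  all_goals
    apply ObjectProperty.hom_ext
    apply Over.OverMorphism.ext
    change Spec.map _ ≫ Spec.map _ = 𝟙 _
    rw [← Spec.map_comp, ← CommRingCat.ofHom_comp, ← Spec.map_id, ← CommRingCat.ofHom_id]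
    congr 2
    ext x
    simp

instance finiteType_tensorProduct : Algebra.FiniteType K (TensorProduct K A B) :=
  Algebra.FiniteType.trans (S := A) inferInstance inferInstance

theorem pullbackSpecIso_hom_specMap (R S T : Type u) [CommRing R] [CommRing S] [CommRing T]
    [Algebra R S] [Algebra R T] :
    (pullbackSpecIso R S T).hom ≫
        Spec.map (CommRingCat.ofHom (algebraMap R (TensorProduct R S T))) =
      Limits.pullback.fst (Spec.map (CommRingCat.ofHom (algebraMap R S)))
        (Spec.map (CommRingCat.ofHom (algebraMap R T))) ≫
        Spec.map (CommRingCat.ofHom (algebraMap R S)) := by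
  rw [← Iso.eq_inv_comp, ← Category.assoc, pullbackSpecIso_inv_fst, ← Spec.map_comp,
    ← CommRingCat.ofHom_comp]

theorem varietyClass_specVariety_tensor :
    varietyClass (specVariety K (TensorProduct K A B)) =
      varietyClass (specVariety K A) * varietyClass (specVariety K B) := by
  rw [← varietyClass_tensor]
  refine (varietyClass_eq_of_iso (ObjectProperty.isoMk _
    (Over.isoMk (pullbackSpecIso K A B) ?_))).symm
  exact pullbackSpecIso_hom_specMap K A B

theorem varietyClass_specVariety_self : varietyClass (specVariety K K) = 1 := by
  rw [← varietyClass_unit]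
  have h : Spec.map (CommRingCat.ofHom (algebraMap K K)) = 𝟙 (Spec (CommRingCat.of K)) := by
    rw [Algebra.algebraMap_self, CommRingCat.ofHom_id, Spec.map_id]
  have e : (specVariety K K).obj ≅ 𝟙_ (Over (Spec (CommRingCat.of K))) :=
    eqToIso (congrArg Over.mk h)
  exact varietyClass_eq_of_iso (ObjectProperty.isoMk _ e)

instance finiteType_localizationAway (h : A) : Algebra.FiniteType K (Localization.Away h) :=
  have : Algebra.FiniteType A (Localization.Away h) :=
    IsLocalization.finiteType_of_monoid_fg (.powers h) _
  Algebra.FiniteType.trans (S := A) inferInstance inferInstance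

/-- The scissor relation for `V(h)` and `D(h)`. Both pieces are again affine, so every decomposition
in the proof can go through this case. -/
theorem varietyClass_specVariety_eq_add (h : A) :
    varietyClass (specVariety K A) = varietyClass (specVariety K (A ⧸ Ideal.span {h})) +
      varietyClass (specVariety K (Localization.Away h)) := by
  refine varietyClass_eq_add (specVarietyMap (Ideal.Quotient.mkₐ K _))
    (specVarietyMap (IsScalarTower.toAlgHom K A _)) ?_ ?_ ?_
  · rw [specVarietyMap_left]
    exact IsClosedImmersion.spec_of_surjective _ Ideal.Quotient.mk_surjective
  · rw [specVarietyMap_left]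
    exact inferInstanceAs (IsOpenImmersion (Spec.map (CommRingCat.ofHom (algebraMap A _))))
  · have h1 : Set.range (PrimeSpectrum.comap (Ideal.Quotient.mkₐ K (Ideal.span {h})).toRingHom) =
        PrimeSpectrum.zeroLocus {h} := by
      refine (range_comap_of_surjective _ _ Ideal.Quotient.mk_surjective).trans ?_
      rw [← PrimeSpectrum.zeroLocus_span {h}]
      congr 2
      exact Ideal.mk_ker
    have h2 : Set.range (PrimeSpectrum.comap
        (IsScalarTower.toAlgHom K A (Localization.Away h)).toRingHom) =
        PrimeSpectrum.basicOpen h :=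
      PrimeSpectrum.localization_away_comap_range (Localization.Away h) h
    have h3 := (isCompl_compl (x := PrimeSpectrum.zeroLocus {h}))
    rw [← PrimeSpectrum.basicOpen_eq_zeroLocus_compl, ← h1, ← h2] at h3
    exact h3

theorem basicOpenIsoSpecAway_hom_specMap_algebraMap (R : Type u) {S : Type u} [CommRing R]
    [CommRing S] [Algebra R S] (h : S) :
    (basicOpenIsoSpecAway (R := CommRingCat.of S) h).hom ≫
        Spec.map (CommRingCat.ofHom (algebraMap R (Localization.Away h))) =
      Scheme.Opens.ι (X := Spec (CommRingCat.of S)) (PrimeSpectrum.basicOpen h) ≫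
        Spec.map (CommRingCat.ofHom (algebraMap R S)) := by
  have : CommRingCat.ofHom (algebraMap R (Localization.Away h)) =
      CommRingCat.ofHom (algebraMap R S) ≫
        CommRingCat.ofHom (algebraMap S (Localization.Away h)) := rfl
  rw [this, Spec.map_comp]
  exact (Category.assoc _ _ _).symm.trans (congrArg
    (· ≫ Spec.map (CommRingCat.ofHom (algebraMap R S)))
    (basicOpenIsoSpecAway_hom_SpecMap (R := CommRingCat.of S) h))

theorem varietyClass_openVariety_basicOpen (h : A) :
    varietyClass (openVariety K (PrimeSpectrum.basicOpen h)) =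
      varietyClass (specVariety K (Localization.Away h)) := by
  refine varietyClass_eq_of_iso (ObjectProperty.isoMk _
    (Over.isoMk (basicOpenIsoSpecAway (R := CommRingCat.of A) h) ?_))
  exact basicOpenIsoSpecAway_hom_specMap_algebraMap K h

end AffineClass

/-! ### Classes of loci in affine space, by their functors of points -/

section Locus

variable {K : Type u} [Field K]

/-- A family of sets of `R`-points of the affine space with coordinates indexed by `ι`. -/
abbrev Locus (K : Type u) [Field K] (ι : Type u) : Type (u + 1) :=
  ∀ (R : Type u) [CommRing R] [Algebra K R], Set (ι → R)

/-- The `K`-algebra `A` with the tuple `x` represents the locus `S`. -/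
structure Represents {ι : Type u} (S : Locus K ι) (A : Type u) [CommRing A] [Algebra K A]
    (x : ι → A) : Prop where
  map_mem : ∀ (R : Type u) [CommRing R] [Algebra K R] (φ : A →ₐ[K] R), φ ∘ x ∈ S R
  exists_map : ∀ (R : Type u) [CommRing R] [Algebra K R], ∀ p ∈ S R, ∃ φ : A →ₐ[K] R, φ ∘ x = p
  ext : ∀ (R : Type u) [CommRing R] [Algebra K R] (φ ψ : A →ₐ[K] R), φ ∘ x = ψ ∘ x → φ = ψ

/-- The locus `S` is represented by an affine variety of class `c`. -/
def HasClass {ι : Type u} (S : Locus K ι) (c : GrothendieckRing K) : Prop :=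
  ∃ (A : Type u) (_ : CommRing A) (_ : Algebra K A) (_ : Algebra.FiniteType K A) (x : ι → A),
    Represents S A x ∧ varietyClass (specVariety K A) = c

variable {ι κ : Type u}

theorem Represents.mem {S : Locus K ι} {A : Type u} [CommRing A] [Algebra K A] {x : ι → A}
    (h : Represents S A x) : x ∈ S A := h.map_mem A (AlgHom.id K A)

/-- Yoneda: each of two representing algebras carries a point of the locus, hence receives a map
from the other, and these maps are mutually inverse. -/
theorem HasClass.unique {S : Locus K ι} {c c' : GrothendieckRing K} (h : HasClass S c)
    (h' : HasClass S c') : c = c' := by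
  obtain ⟨A, _, _, _, x, hx, rfl⟩ := h
  obtain ⟨B, _, _, _, y, hy, rfl⟩ := h'
  obtain ⟨φ, hφ⟩ := hx.exists_map B y hy.mem
  obtain ⟨ψ, hψ⟩ := hy.exists_map A x hx.mem
  refine varietyClass_specVariety_congr (AlgEquiv.ofAlgHom φ ψ ?_ ?_)
  · refine hy.ext _ _ _ ?_
    rw [AlgHom.coe_comp, Function.comp_assoc, hψ, hφ, AlgHom.coe_id, Function.id_comp]
  · refine hx.ext _ _ _ ?_
    rw [AlgHom.coe_comp, Function.comp_assoc, hφ, hψ, AlgHom.coe_id, Function.id_comp]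

/-- A natural bijection of loci preserves the class. -/
theorem HasClass.of_bijection {S : Locus K ι} {S' : Locus K κ} {c : GrothendieckRing K}
    (h : HasClass S c) (f : ∀ (R : Type u) [CommRing R] [Algebra K R], (ι → R) → κ → R)
    (g : ∀ (R : Type u) [CommRing R] [Algebra K R], (κ → R) → ι → R)
    (hf : ∀ (R : Type u) [CommRing R] [Algebra K R], ∀ p ∈ S R, f R p ∈ S' R)
    (hg : ∀ (R : Type u) [CommRing R] [Algebra K R], ∀ p ∈ S' R, g R p ∈ S R)
    (hgf : ∀ (R : Type u) [CommRing R] [Algebra K R], ∀ p ∈ S R, g R (f R p) = p)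
    (hfg : ∀ (R : Type u) [CommRing R] [Algebra K R], ∀ p ∈ S' R, f R (g R p) = p)
    (hnat : ∀ (R R' : Type u) [CommRing R] [Algebra K R] [CommRing R'] [Algebra K R']
      (φ : R →ₐ[K] R'), ∀ p ∈ S R, f R' (φ ∘ p) = φ ∘ f R p) :
    HasClass S' c := by
  obtain ⟨A, _, _, _, x, hx, rfl⟩ := h
  refine ⟨A, _, _, inferInstance, f A x, ⟨?_, ?_, ?_⟩, rfl⟩
  · intro R _ _ φ
    rw [← hnat _ _ φ x hx.mem]
    exact hf _ _ (hx.map_mem _ φ)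
  · intro R _ _ p hp
    obtain ⟨φ, hφ⟩ := hx.exists_map R _ (hg R p hp)
    exact ⟨φ, by rw [← hnat _ _ φ x hx.mem, hφ, hfg R p hp]⟩
  · intro R _ _ φ ψ h
    refine hx.ext _ _ _ ?_
    rw [← hnat _ _ φ x hx.mem, ← hnat _ _ ψ x hx.mem] at h
    rw [← hgf R _ (hx.map_mem _ φ), h, hgf R _ (hx.map_mem _ ψ)]

theorem HasClass.congr {S S' : Locus K ι} {c : GrothendieckRing K} (h : HasClass S c)
    (hS : ∀ (R : Type u) [CommRing R] [Algebra K R] (p : ι → R), p ∈ S R ↔ p ∈ S' R) :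
    HasClass S' c :=
  h.of_bijection (fun _ _ _ p => p) (fun _ _ _ p => p) (fun R _ _ p => (hS R p).1)
    (fun R _ _ p => (hS R p).2) (fun _ _ _ _ _ => rfl) (fun _ _ _ _ _ => rfl)
    (fun _ _ _ _ _ _ _ _ _ => rfl)

theorem HasClass.reindex {S : Locus K ι} {c : GrothendieckRing K} (h : HasClass S c) (e : κ ≃ ι) :
    HasClass (fun R _ _ => {p : κ → R | p ∘ e.symm ∈ S R}) c :=
  h.of_bijection (fun _ _ _ p => p ∘ e) (fun _ _ _ p => p ∘ e.symm)
    (fun R _ _ p hp => by simpa [Function.comp_assoc] using hp) (fun R _ _ p hp => hp)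
    (fun _ _ _ _ _ => by simp [Function.comp_assoc])
    (fun _ _ _ _ _ => by simp [Function.comp_assoc])
    (fun _ _ _ _ _ _ _ _ _ => rfl)

theorem HasClass.prod {S : Locus K ι} {S' : Locus K κ} {c c' : GrothendieckRing K}
    (h : HasClass S c) (h' : HasClass S' c') :
    HasClass (fun R _ _ => {p : ι ⊕ κ → R | p ∘ Sum.inl ∈ S R ∧ p ∘ Sum.inr ∈ S' R}) (c * c') := by
  obtain ⟨A, _, _, _, x, hx, rfl⟩ := h
  obtain ⟨B, _, _, _, y, hy, rfl⟩ := h'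
  refine ⟨TensorProduct K A B, inferInstance, inferInstance, inferInstance,
    Sum.elim (Algebra.TensorProduct.includeLeft (R := K) (S := K) (A := A) (B := B) ∘ x)
      (Algebra.TensorProduct.includeRight (R := K) (A := A) (B := B) ∘ y), ⟨?_, ?_, ?_⟩,
    varietyClass_specVariety_tensor⟩
  · intro R _ _ φ
    exact ⟨hx.map_mem R (φ.comp Algebra.TensorProduct.includeLeft),
      hy.map_mem R (φ.comp Algebra.TensorProduct.includeRight)⟩
  · rintro R _ _ p ⟨hp, hp'⟩
    obtain ⟨φ, hφ⟩ := hx.exists_map R _ hp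
    obtain ⟨ψ, hψ⟩ := hy.exists_map R _ hp'
    refine ⟨Algebra.TensorProduct.productMap φ ψ, funext ?_⟩
    rintro (i | i)
    · simpa using congrFun hφ i
    · simpa using congrFun hψ i
  · intro R _ _ φ ψ h
    refine Algebra.TensorProduct.ext' fun a b => ?_
    have h1 : φ.comp Algebra.TensorProduct.includeLeft =
        ψ.comp Algebra.TensorProduct.includeLeft :=
      hx.ext R _ _ (funext fun i => congrFun h (Sum.inl i))
    have h2 : φ.comp Algebra.TensorProduct.includeRight =
        ψ.comp Algebra.TensorProduct.includeRight :=
      hy.ext R _ _ (funext fun i => congrFun h (Sum.inr i))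
    have h3 : a ⊗ₜ[K] b =
        (Algebra.TensorProduct.includeLeft (R := K) (S := K) (A := A) (B := B) a) *
        (Algebra.TensorProduct.includeRight (R := K) (A := A) (B := B) b) := by simp
    rw [h3, map_mul, map_mul]
    exact congrArg₂ (· * ·) (DFunLike.congr_fun h1 a) (DFunLike.congr_fun h2 b)

theorem aeval_algHom_comp {R R' : Type*} [CommRing R] [Algebra K R] [CommRing R'] [Algebra K R']
    (φ : R →ₐ[K] R') (p : ι → R) (h : MvPolynomial ι K) :
    MvPolynomial.aeval (φ ∘ p) h = φ (MvPolynomial.aeval p h) :=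
  (MvPolynomial.comp_aeval_apply p φ h).symm

theorem Represents.quotient {S : Locus K ι} {A : Type u} [CommRing A] [Algebra K A] {x : ι → A}
    (hx : Represents S A x) {h : MvPolynomial ι K} {a : A} (ha : MvPolynomial.aeval x h = a) :
    Represents (fun R _ _ => {p | p ∈ S R ∧ MvPolynomial.aeval p h = 0} : Locus K ι)
      (A ⧸ Ideal.span {a})
      (Ideal.Quotient.mkₐ K _ ∘ x) := by
  refine ⟨?_, ?_, ?_⟩
  · intro R _ _ φ
    refine ⟨hx.map_mem R (φ.comp (Ideal.Quotient.mkₐ K _)), ?_⟩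
    rw [aeval_algHom_comp, aeval_algHom_comp, ha, Ideal.Quotient.mkₐ_eq_mk,
      Ideal.Quotient.eq_zero_iff_mem.mpr (Ideal.mem_span_singleton_self _), map_zero]
  · rintro R _ _ p ⟨hp, hp'⟩
    obtain ⟨φ, rfl⟩ := hx.exists_map R p hp
    rw [aeval_algHom_comp, ha] at hp'
    refine ⟨Ideal.Quotient.liftₐ _ φ fun b hb => ?_, rfl⟩
    obtain ⟨c, rfl⟩ := Ideal.mem_span_singleton'.mp hb
    rw [map_mul, hp', mul_zero]
  · intro R _ _ φ ψ h
    exact Ideal.Quotient.algHom_ext K (hx.ext R (φ.comp _) (ψ.comp _) h)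

theorem Represents.localization {S : Locus K ι} {A : Type u} [CommRing A] [Algebra K A]
    {x : ι → A} (hx : Represents S A x) {h : MvPolynomial ι K} {a : A}
    (ha : MvPolynomial.aeval x h = a) :
    Represents (fun R _ _ => {p | p ∈ S R ∧ IsUnit (MvPolynomial.aeval p h)} : Locus K ι)
      (Localization.Away a) (IsScalarTower.toAlgHom K A _ ∘ x) := by
  refine ⟨?_, ?_, ?_⟩
  · intro R _ _ φ
    refine ⟨hx.map_mem R (φ.comp (IsScalarTower.toAlgHom K A _)), ?_⟩
    rw [aeval_algHom_comp, aeval_algHom_comp, ha]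
    exact (IsLocalization.Away.algebraMap_isUnit a).map φ
  · rintro R _ _ p ⟨hp, hp'⟩
    obtain ⟨φ, rfl⟩ := hx.exists_map R p hp
    rw [aeval_algHom_comp, ha] at hp'
    refine ⟨IsLocalization.liftAlgHom (M := Submonoid.powers a) (f := φ) ?_, ?_⟩
    · rintro ⟨_, n, rfl⟩
      simpa using hp'.pow n
    · funext i
      simp
  · intro R _ _ φ ψ hφ
    refine IsLocalization.algHom_ext (Submonoid.powers a) ?_
    exact hx.ext R (φ.comp (IsScalarTower.toAlgHom K A _))
      (ψ.comp (IsScalarTower.toAlgHom K A _)) hφ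

/-- The closed and the open part of a locus, defined by the vanishing and the invertibility of a
polynomial. -/
theorem HasClass.exists_eq_add {S : Locus K ι} {c : GrothendieckRing K} (hS : HasClass S c)
    (h : MvPolynomial ι K) :
    ∃ c₀ c₁, HasClass (fun R _ _ => {p | p ∈ S R ∧ MvPolynomial.aeval p h = 0}) c₀ ∧
      HasClass (fun R _ _ => {p | p ∈ S R ∧ IsUnit (MvPolynomial.aeval p h)}) c₁ ∧
      c = c₀ + c₁ := by
  obtain ⟨A, _, _, _, x, hx, rfl⟩ := hS
  exact ⟨_, _, ⟨_, inferInstance, inferInstance, inferInstance, _, hx.quotient rfl, rfl⟩,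
    ⟨_, inferInstance, inferInstance, inferInstance, _, hx.localization rfl, rfl⟩,
    varietyClass_specVariety_eq_add _⟩

theorem HasClass.eq_add {S S₀ S₁ : Locus K ι} {c c₀ c₁ : GrothendieckRing K} (hS : HasClass S c)
    (h : MvPolynomial ι K) (h₀ : HasClass S₀ c₀) (h₁ : HasClass S₁ c₁)
    (hS₀ : ∀ (R : Type u) [CommRing R] [Algebra K R] (p : ι → R),
      p ∈ S₀ R ↔ p ∈ S R ∧ MvPolynomial.aeval p h = 0)
    (hS₁ : ∀ (R : Type u) [CommRing R] [Algebra K R] (p : ι → R),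
      p ∈ S₁ R ↔ p ∈ S R ∧ IsUnit (MvPolynomial.aeval p h)) : c = c₀ + c₁ := by
  obtain ⟨c₀', c₁', h₀', h₁', rfl⟩ := hS.exists_eq_add h
  rw [h₀.unique (h₀'.congr fun R _ _ p => (hS₀ R p).symm),
    h₁.unique (h₁'.congr fun R _ _ p => (hS₁ R p).symm)]

/-- The locus where `f` vanishes and `g` is invertible. -/
def basicLocus (f g : MvPolynomial ι K) : Locus K ι :=
  fun _ _ _ => {p | MvPolynomial.aeval p f = 0 ∧ IsUnit (MvPolynomial.aeval p g)}

theorem represents_univ :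
    Represents (fun _ _ _ => Set.univ : Locus K ι) (MvPolynomial ι K) MvPolynomial.X :=
  ⟨fun _ _ _ _ => trivial,
    fun _ _ _ p _ => ⟨MvPolynomial.aeval p, funext fun i => MvPolynomial.aeval_X p i⟩,
    fun _ _ _ _ _ h => MvPolynomial.algHom_ext fun i => congrFun h i⟩

theorem hasClass_univ [Finite ι] : HasClass (fun _ _ _ => Set.univ : Locus K ι)
    (varietyClass (specVariety K (MvPolynomial ι K))) :=
  ⟨MvPolynomial ι K, _, _, inferInstance, MvPolynomial.X, represents_univ, rfl⟩

theorem hasClass_isUnit [Finite ι] (g : MvPolynomial ι K) :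
    HasClass (fun _ _ _ => {p | IsUnit (MvPolynomial.aeval p g)} : Locus K ι)
      (varietyClass (openVariety K (A := MvPolynomial ι K) (PrimeSpectrum.basicOpen g))) := by
  rw [varietyClass_openVariety_basicOpen]
  have h : HasClass _ (varietyClass (specVariety K (Localization.Away g))) :=
    ⟨_, inferInstance, inferInstance, inferInstance, _,
      represents_univ.localization (MvPolynomial.aeval_X_left_apply g), rfl⟩
  exact h.congr fun R _ _ p => by simp

/-- Supplies some class to which additivity can be applied. The class itself is then found from the
pieces. -/
theorem exists_hasClass_basicLocus [Finite ι] (f g : MvPolynomial ι K) :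
    ∃ c, HasClass (basicLocus f g) c := by
  obtain ⟨c, -, hc, -, -⟩ := (hasClass_univ (K := K) (ι := ι)).exists_eq_add f
  obtain ⟨-, c', -, hc', -⟩ := hc.exists_eq_add g
  exact ⟨c', hc'.congr fun R _ _ p => by simp [basicLocus]⟩

/-- The class of a basic locus is the sum of the classes of the parts where `h` vanishes and where
`h` is invertible. -/
theorem hasClass_basicLocus_of_pieces [Finite ι] {f g : MvPolynomial ι K} (h : MvPolynomial ι K)
    {S₀ S₁ : Locus K ι} {c₀ c₁ : GrothendieckRing K} (h₀ : HasClass S₀ c₀) (h₁ : HasClass S₁ c₁)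
    (hS₀ : ∀ (R : Type u) [CommRing R] [Algebra K R] (p : ι → R),
      p ∈ S₀ R ↔ (MvPolynomial.aeval p f = 0 ∧ IsUnit (MvPolynomial.aeval p g)) ∧
        MvPolynomial.aeval p h = 0)
    (hS₁ : ∀ (R : Type u) [CommRing R] [Algebra K R] (p : ι → R),
      p ∈ S₁ R ↔ (MvPolynomial.aeval p f = 0 ∧ IsUnit (MvPolynomial.aeval p g)) ∧
        IsUnit (MvPolynomial.aeval p h)) : HasClass (basicLocus f g) (c₀ + c₁) := by
  obtain ⟨c, hc⟩ := exists_hasClass_basicLocus f g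
  rwa [← hc.eq_add h h₀ h₁ hS₀ hS₁]

/-! ### Classes of affine space and of loci on the line -/

theorem hasClass_origin : HasClass (fun _ _ _ => {p | p PUnit.unit = 0} : Locus K PUnit) 1 :=
  ⟨K, inferInstance, inferInstance, inferInstance, fun _ => 0,
    ⟨fun R _ _ φ => by simp, fun R _ _ p hp => ⟨Algebra.ofId K R, by
      funext i
      simpa using hp.symm⟩, fun R _ _ φ ψ _ => Subsingleton.elim _ _⟩,
    varietyClass_specVariety_self⟩

theorem hasClass_line : HasClass (fun _ _ _ => Set.univ : Locus K PUnit) (lefschetz K) :=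
  ⟨K[X], inferInstance, inferInstance, inferInstance, fun _ => X, ⟨fun _ _ _ _ => trivial,
    fun R _ _ p _ => ⟨Polynomial.aeval (p PUnit.unit), funext fun i => by simp⟩,
    fun R _ _ φ ψ h => Polynomial.algHom_ext (congrFun h PUnit.unit)⟩, rfl⟩

theorem varietyClass_mvPolynomial [Fintype ι] :
    varietyClass (specVariety K (MvPolynomial ι K)) = lefschetz K ^ Fintype.card ι := by
  refine hasClass_univ.unique ?_
  refine Fintype.induction_empty_option
    (P := fun ι _ => HasClass (fun _ _ _ => Set.univ : Locus K ι) (lefschetz K ^ Fintype.card ι))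
    (fun α β _ e h => ?_) ?_ (fun α _ h => ?_) ι
  · let := Fintype.ofEquiv β e.symm
    rw [← Fintype.card_congr e]
    exact (h.reindex e.symm).congr fun R _ _ p => by simp
  · rw [Fintype.card_pempty, pow_zero]
    exact ⟨K, inferInstance, inferInstance, inferInstance, PEmpty.elim,
      ⟨fun _ _ _ _ => trivial, fun R _ _ p _ => ⟨Algebra.ofId K R, funext fun i => i.elim⟩,
        fun _ _ _ _ _ _ => Subsingleton.elim _ _⟩, varietyClass_specVariety_self⟩
  · rw [Fintype.card_option, pow_succ]
    exact ((h.prod hasClass_line).reindex (Equiv.optionEquivSumPUnit α)).congr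
      fun R _ _ p => by simp

theorem hasClass_units : HasClass (fun _ _ _ => {p | IsUnit (p PUnit.unit)} : Locus K PUnit)
    (lefschetz K - 1) := by
  obtain ⟨c₀, c₁, h₀, h₁, h⟩ := (hasClass_line (K := K)).exists_eq_add (MvPolynomial.X PUnit.unit)
  rw [h, h₀.unique (hasClass_origin.congr fun R _ _ p => by simp), add_sub_cancel_left]
  exact h₁.congr fun R _ _ p => by simp

theorem hasClass_point (a : K) :
    HasClass (fun R _ _ => {p | p PUnit.unit = algebraMap K R a} : Locus K PUnit) 1 :=
  hasClass_origin.of_bijection (fun R _ _ p i => p i + algebraMap K R a)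
    (fun R _ _ p i => p i - algebraMap K R a) (fun R _ _ p hp => by simpa using hp)
    (fun R _ _ p hp => by simpa [sub_eq_zero] using hp) (fun R _ _ p hp => by simp)
    (fun R _ _ p hp => by simp) (fun R R' _ _ _ _ φ p hp => by funext i; simp)

theorem hasClass_units_sub_one :
    HasClass (fun _ _ _ => {p | IsUnit (p PUnit.unit) ∧ IsUnit (1 - p PUnit.unit)} :
      Locus K PUnit) (lefschetz K - 2) := by
  obtain ⟨c₀, c₁, h₀, h₁, h⟩ := (hasClass_units (K := K)).exists_eq_add
    (1 - MvPolynomial.X PUnit.unit)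
  have : c₁ = lefschetz K - 2 := by
    rw [h₀.unique ((hasClass_point 1).congr fun R _ _ p => ?_)] at h
    · rw [eq_sub_iff_add_eq, ← one_add_one_eq_two, ← add_assoc, add_comm c₁, ← h, sub_add_cancel]
    · simp only [map_one, Set.mem_ofPred_eq, map_sub, MvPolynomial.aeval_X, sub_eq_zero]
      exact ⟨fun hp => by simp [hp], fun hp => hp.2.symm⟩
  rw [← this]
  exact h₁.congr fun R _ _ p => by simp

end Locus

/-! ### Integral powers of units -/

section UnitZPow

open Classical in
/-- The power of a unit with an integral exponent. -/
noncomputable def unitZPow {R : Type*} [CommRing R] (ε : ℤ) (x : R) : R :=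
  -- The value `0` off the units makes the function total, so that it can appear in maps defined on
  -- all tuples.
  if h : IsUnit x then ((h.unit ^ ε : Rˣ) : R) else 0

theorem unitZPow_coe {R : Type*} [CommRing R] (ε : ℤ) (x : Rˣ) :
    unitZPow ε (x : R) = ((x ^ ε : Rˣ) : R) := by
  rw [unitZPow, dif_pos x.isUnit, IsUnit.unit_of_val_units]

theorem map_unitZPow {R R' F : Type*} [CommRing R] [CommRing R'] [FunLike F R R']
    [RingHomClass F R R'] (φ : F) (ε : ℤ) {x : R} (hx : IsUnit x) :
    φ (unitZPow ε x) = unitZPow ε (φ x) := by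
  obtain ⟨x, rfl⟩ := hx
  have : φ (x : R) = (Units.map (φ : R →* R') x : R'ˣ) := rfl
  rw [this, unitZPow_coe, unitZPow_coe, ← map_zpow]
  rfl

end UnitZPow

/-! ### Scaling -/

section Scaling

variable {K : Type u} [Field K] {ι κ : Type u}

/-- The ratio of `Φ` and `Ψ` has weight one for the action of the multiplicative group on the affine
space that scales the coordinates with exponent `ε`. -/
def Scales (ε : ℤ) (Φ Ψ : MvPolynomial ι K) : Prop :=
  ∀ (R : Type u) [CommRing R] [Algebra K R] (x : Rˣ) (p : ι → R), ∃ y : Rˣ,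
    MvPolynomial.aeval (fun i => unitZPow ε (x : R) * p i) Φ =
      x * y * MvPolynomial.aeval p Φ ∧
    MvPolynomial.aeval (fun i => unitZPow ε (x : R) * p i) Ψ = y * MvPolynomial.aeval p Ψ

/-- Scaling by `x⁻¹` with exponent `ε` is scaling by `x` with exponent `-ε`, and it gives `Ψ / Φ`
weight one. This is what reduces parallel composition to series composition. The unit `y` absorbs
the common factor, so no degree has to be recorded. -/
theorem Scales.swap {ε : ℤ} {Φ Ψ : MvPolynomial ι K} (h : Scales ε Φ Ψ) : Scales (-ε) Ψ Φ := by
  intro R _ _ x p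
  obtain ⟨y, h1, h2⟩ := h R x⁻¹ p
  have : unitZPow (-ε) (x : R) = unitZPow ε ((x⁻¹ : Rˣ) : R) := by
    rw [unitZPow_coe, unitZPow_coe, zpow_neg, inv_zpow]
  refine ⟨x⁻¹ * y, ?_, ?_⟩
  · rw [this, h2, Units.val_mul, Units.mul_inv_cancel_left]
  · rw [this, h1, Units.val_mul]

/-- The ratio of the values of `Φ` and `Ψ`. -/
noncomputable def ratio (Φ Ψ : MvPolynomial ι K) {R : Type u} [CommRing R] [Algebra K R]
    (p : ι → R) : R :=
  MvPolynomial.aeval p Φ * unitZPow (-1) (MvPolynomial.aeval p Ψ)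

theorem ratio_eq {Φ Ψ : MvPolynomial ι K} {R : Type u} [CommRing R] [Algebra K R]
    {p : ι → R} {x : R} (h : MvPolynomial.aeval p Φ = x * MvPolynomial.aeval p Ψ)
    (hu : IsUnit (MvPolynomial.aeval p Ψ)) : ratio Φ Ψ p = x := by
  obtain ⟨y, hy⟩ := hu
  rw [ratio, h, ← hy, unitZPow_coe, zpow_neg_one, Units.mul_inv_cancel_right]

theorem ratio_mul {Φ Ψ : MvPolynomial ι K} {R : Type u} [CommRing R] [Algebra K R]
    {p : ι → R} (hu : IsUnit (MvPolynomial.aeval p Ψ)) :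
    MvPolynomial.aeval p Φ = ratio Φ Ψ p * MvPolynomial.aeval p Ψ := by
  obtain ⟨y, hy⟩ := hu
  rw [ratio, ← hy, unitZPow_coe, zpow_neg_one, Units.inv_mul_cancel_right]

theorem isUnit_ratio {Φ Ψ : MvPolynomial ι K} {R : Type u} [CommRing R] [Algebra K R]
    {p : ι → R} (hu : IsUnit (MvPolynomial.aeval p Φ)) (hu' : IsUnit (MvPolynomial.aeval p Ψ)) :
    IsUnit (ratio Φ Ψ p) := by
  rw [ratio_mul (Φ := Φ) hu'] at hu
  exact isUnit_of_mul_isUnit_left hu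

/-- The locus where `Φ` and `Ψ` agree and are invertible. -/
def fiberLocus (Φ Ψ : MvPolynomial ι K) : Locus K ι :=
  fun _ _ _ => {p | MvPolynomial.aeval p Φ = MvPolynomial.aeval p Ψ ∧
    IsUnit (MvPolynomial.aeval p Ψ)}

theorem fiberLocus_swap {Φ Ψ : MvPolynomial ι K} {c : GrothendieckRing K}
    (h : HasClass (fiberLocus Φ Ψ) c) : HasClass (fiberLocus Ψ Φ) c :=
  h.congr fun _ _ _ _ => ⟨fun hp => ⟨hp.1.symm, hp.1 ▸ hp.2⟩, fun hp => ⟨hp.1.symm, hp.1 ▸ hp.2⟩⟩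

theorem Scales.of_mem_fiberLocus {ε : ℤ} {Φ Ψ : MvPolynomial ι K} (h : Scales ε Φ Ψ)
    {R : Type u} [CommRing R] [Algebra K R] {x : R} (hx : IsUnit x) {p : ι → R}
    (hp : p ∈ fiberLocus Φ Ψ R) :
    MvPolynomial.aeval (fun i => unitZPow ε x * p i) Φ =
      x * MvPolynomial.aeval (fun i => unitZPow ε x * p i) Ψ ∧
    IsUnit (MvPolynomial.aeval (fun i => unitZPow ε x * p i) Ψ) := by
  obtain ⟨x, rfl⟩ := hx
  obtain ⟨y, h1, h2⟩ := h R x p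
  rw [h1, h2, hp.1, mul_assoc]
  exact ⟨rfl, y.isUnit.mul hp.2⟩

/-- Scaling by the inverse of the ratio brings the ratio to one. -/
theorem Scales.mem_fiberLocus {ε : ℤ} {Φ Ψ : MvPolynomial ι K} (h : Scales ε Φ Ψ)
    {R : Type u} [CommRing R] [Algebra K R] {p : ι → R}
    (hu : IsUnit (MvPolynomial.aeval p Φ)) (hu' : IsUnit (MvPolynomial.aeval p Ψ)) :
    (fun i => unitZPow (-ε) (ratio Φ Ψ p) * p i) ∈ fiberLocus Φ Ψ R := by
  obtain ⟨x, hx⟩ := isUnit_ratio hu hu'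
  obtain ⟨y, h1, h2⟩ := h R x⁻¹ p
  have : unitZPow (-ε) (x : R) = unitZPow ε ((x⁻¹ : Rˣ) : R) := by
    rw [unitZPow_coe, unitZPow_coe, zpow_neg, inv_zpow]
  rw [fiberLocus, Set.mem_ofPred_eq, ← hx, this, h1, h2, ratio_mul (Φ := Φ) hu', ← hx]
  exact ⟨by rw [mul_right_comm, ← mul_assoc, Units.inv_mul, one_mul, mul_comm],
    y.isUnit.mul hu'⟩

theorem unitZPow_neg_mul {R : Type u} [CommRing R] (ε : ℤ) {x : R} (hx : IsUnit x) (y : R) :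
    unitZPow (-ε) x * (unitZPow ε x * y) = y := by
  obtain ⟨x, rfl⟩ := hx
  rw [unitZPow_coe, unitZPow_coe, ← mul_assoc, ← Units.val_mul, ← zpow_add, neg_add_cancel,
    zpow_zero, Units.val_one, one_mul]

theorem unitZPow_mul_neg {R : Type u} [CommRing R] (ε : ℤ) {x : R} (hx : IsUnit x) (y : R) :
    unitZPow ε x * (unitZPow (-ε) x * y) = y := by
  simpa using unitZPow_neg_mul (-ε) hx y

/-- The locus where `Φ` and `Ψ` are invertible is the product of its fibre and of the multiplicative
group. -/
theorem Scales.hasClass_units {ε : ℤ} {Φ Ψ : MvPolynomial ι K} (h : Scales ε Φ Ψ)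
    {c : GrothendieckRing K} (hc : HasClass (fiberLocus Φ Ψ) c) :
    HasClass (fun _ _ _ => {p | IsUnit (MvPolynomial.aeval p Φ) ∧ IsUnit (MvPolynomial.aeval p Ψ)})
      ((lefschetz K - 1) * c) := by
  -- A unit `x` and a point of ratio one correspond to that point scaled by `x`; conversely, `x` is
  -- recovered as the ratio.
  refine (_root_.hasClass_units.prod hc).of_bijection
    (fun R _ _ q i => unitZPow ε (q (Sum.inl PUnit.unit)) * q (Sum.inr i))
    (fun R _ _ p => Sum.elim (fun _ => ratio Φ Ψ p)
      (fun i => unitZPow (-ε) (ratio Φ Ψ p) * p i)) ?_ ?_ ?_ ?_ ?_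
  · rintro R _ _ q ⟨hq, hq'⟩
    obtain ⟨h1, h2⟩ := h.of_mem_fiberLocus hq hq'
    exact ⟨h1 ▸ hq.mul h2, h2⟩
  · rintro R _ _ p ⟨hp, hp'⟩
    exact ⟨isUnit_ratio hp hp', h.mem_fiberLocus hp hp'⟩
  · rintro R _ _ q ⟨hq, hq'⟩
    obtain ⟨h1, h2⟩ := h.of_mem_fiberLocus hq hq'
    have h3 := ratio_eq h1 h2
    funext i
    rcases i with i | i
    · exact h3
    · change unitZPow (-ε) (ratio _ _ _) * _ = _
      exact (congrArg (fun z => unitZPow (-ε) z * _) h3).trans (unitZPow_neg_mul ε hq _)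
  · rintro R _ _ p ⟨hp, hp'⟩
    funext i
    exact unitZPow_mul_neg ε (isUnit_ratio hp hp') _
  · rintro R R' _ _ _ _ φ q ⟨hq, hq'⟩
    funext i
    simp only [Function.comp_apply, map_mul]
    rw [map_unitZPow φ ε (x := q (Sum.inl PUnit.unit)) hq]

/-- The part of the product of two loci of units where the sum of the ratios is `c`. -/
theorem Scales.hasClass_ratio_add_eq {ε : ℤ} {Φ₁ Ψ₁ : MvPolynomial ι K} (h₁ : Scales ε Φ₁ Ψ₁)
    {Φ₂ Ψ₂ : MvPolynomial κ K} (h₂ : Scales ε Φ₂ Ψ₂) {c₁ c₂ γ : GrothendieckRing K}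
    (hc₁ : HasClass (fiberLocus Φ₁ Ψ₁) c₁) (hc₂ : HasClass (fiberLocus Φ₂ Ψ₂) c₂) (c : ℕ)
    (hγ : HasClass (fun _ _ _ => {p | IsUnit (p PUnit.unit) ∧ IsUnit (c - p PUnit.unit)} :
      Locus K PUnit) γ) :
    HasClass (fun _ _ _ => {p : ι ⊕ κ → _ |
      ((IsUnit (MvPolynomial.aeval (p ∘ Sum.inl) Φ₁) ∧
        IsUnit (MvPolynomial.aeval (p ∘ Sum.inl) Ψ₁)) ∧
      (IsUnit (MvPolynomial.aeval (p ∘ Sum.inr) Φ₂) ∧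
        IsUnit (MvPolynomial.aeval (p ∘ Sum.inr) Ψ₂))) ∧
      MvPolynomial.aeval (p ∘ Sum.inl) Φ₁ * MvPolynomial.aeval (p ∘ Sum.inr) Ψ₂ +
        MvPolynomial.aeval (p ∘ Sum.inl) Ψ₁ * MvPolynomial.aeval (p ∘ Sum.inr) Φ₂ =
      c * (MvPolynomial.aeval (p ∘ Sum.inl) Ψ₁ * MvPolynomial.aeval (p ∘ Sum.inr) Ψ₂)})
      (γ * (c₁ * c₂)) := by
  -- Division by `Ψ₁Ψ₂` turns the equation into a sum of ratios equal to `c`. Hence the first ratio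
  -- is a free parameter `x` with `x` and `c - x` units, and the second ratio is `c - x`.
  have key : ∀ (R : Type u) [CommRing R] [Algebra K R] (p : ι ⊕ κ → R),
      IsUnit (MvPolynomial.aeval (p ∘ Sum.inl) Ψ₁) → IsUnit (MvPolynomial.aeval (p ∘ Sum.inr) Ψ₂) →
      MvPolynomial.aeval (p ∘ Sum.inl) Φ₁ * MvPolynomial.aeval (p ∘ Sum.inr) Ψ₂ +
        MvPolynomial.aeval (p ∘ Sum.inl) Ψ₁ * MvPolynomial.aeval (p ∘ Sum.inr) Φ₂ =
      c * (MvPolynomial.aeval (p ∘ Sum.inl) Ψ₁ * MvPolynomial.aeval (p ∘ Sum.inr) Ψ₂) →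
      ratio Φ₂ Ψ₂ (p ∘ Sum.inr) = c - ratio Φ₁ Ψ₁ (p ∘ Sum.inl) := by
    intro R _ _ p hu hv hp
    rw [ratio_mul (Φ := Φ₁) hu, ratio_mul (Φ := Φ₂) hv] at hp
    refine ((hu.mul hv).mul_left_inj).mp ?_
    linear_combination hp
  refine (hγ.prod (hc₁.prod hc₂)).of_bijection
    (fun R _ _ q => Sum.elim
      (fun i => unitZPow ε (q (Sum.inl PUnit.unit)) * q (Sum.inr (Sum.inl i)))
      (fun i => unitZPow ε (c - q (Sum.inl PUnit.unit)) * q (Sum.inr (Sum.inr i))))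
    (fun R _ _ p => Sum.elim (fun _ => ratio Φ₁ Ψ₁ (p ∘ Sum.inl)) (Sum.elim
      (fun i => unitZPow (-ε) (ratio Φ₁ Ψ₁ (p ∘ Sum.inl)) * p (Sum.inl i))
      (fun i => unitZPow (-ε) (ratio Φ₂ Ψ₂ (p ∘ Sum.inr)) * p (Sum.inr i)))) ?_ ?_ ?_ ?_ ?_
  · rintro R _ _ q ⟨⟨hx, hy⟩, hq₁, hq₂⟩
    obtain ⟨h3, h4⟩ := h₁.of_mem_fiberLocus hx hq₁
    obtain ⟨h5, h6⟩ := h₂.of_mem_fiberLocus hy hq₂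
    refine ⟨⟨⟨h3 ▸ hx.mul h4, h4⟩, ⟨h5 ▸ hy.mul h6, h6⟩⟩, ?_⟩
    refine (congrArg₂ (fun a b => a * _ + _ * b) h3 h5).trans ?_
    simp only [Function.comp_def, Sum.elim_inl, Sum.elim_inr]
    ring
  · rintro R _ _ p ⟨⟨⟨hp1, hp2⟩, hp3, hp4⟩, hp⟩
    refine ⟨⟨isUnit_ratio hp1 hp2, ?_⟩, h₁.mem_fiberLocus hp1 hp2, h₂.mem_fiberLocus hp3 hp4⟩
    have := key R p hp2 hp4 hp
    simp only [Function.comp_def, Sum.elim_inl] at this ⊢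
    rw [← this]
    exact isUnit_ratio hp3 hp4
  · rintro R _ _ q ⟨⟨hx, hy⟩, hq₁, hq₂⟩
    obtain ⟨h3, h4⟩ := h₁.of_mem_fiberLocus hx hq₁
    obtain ⟨h5, h6⟩ := h₂.of_mem_fiberLocus hy hq₂
    have h7 := ratio_eq h3 h4
    have h8 := ratio_eq h5 h6
    funext i
    rcases i with i | i | i
    · exact h7
    · exact (congrArg (fun z => unitZPow (-ε) z * _) h7).trans (unitZPow_neg_mul ε hx _)
    · exact (congrArg (fun z => unitZPow (-ε) z * _) h8).trans (unitZPow_neg_mul ε hy _)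
  · rintro R _ _ p ⟨⟨⟨hp1, hp2⟩, hp3, hp4⟩, hp⟩
    have := key R p hp2 hp4 hp
    funext i
    rcases i with i | i
    · exact unitZPow_mul_neg ε (isUnit_ratio hp1 hp2) _
    · simp only [Sum.elim_inl, Sum.elim_inr]
      rw [← this]
      exact unitZPow_mul_neg ε (isUnit_ratio hp3 hp4) _
  · rintro R R' _ _ _ _ φ q ⟨⟨hx, hy⟩, hq₁, hq₂⟩
    funext i
    rcases i with i | i
    · simp only [Function.comp_apply, Sum.elim_inl, map_mul]
      rw [map_unitZPow φ ε (x := q (Sum.inl PUnit.unit)) hx]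
    · simp only [Function.comp_apply, Sum.elim_inr, map_mul]
      rw [map_unitZPow φ ε (x := c - q (Sum.inl PUnit.unit)) hy]
      simp

end Scaling

/-! ### Pairs of polynomials with Tate classes -/

section TatePair

variable {K : Type u} [Field K] {ι κ : Type u}

/-- The classes of the loci that `Φ` and `Ψ` define are polynomials in `𝕃`, with bounds on the
degrees in terms of the dimension `n` of the affine space. -/
def IsTatePair (Φ Ψ : MvPolynomial ι K) (n : ℕ) : Prop :=
  ∃ a b f : ℤ[X], HasClass (basicLocus Φ Ψ) (aeval (lefschetz K) a) ∧
    HasClass (basicLocus Ψ Φ) (aeval (lefschetz K) b) ∧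
    HasClass (fiberLocus Φ Ψ) (aeval (lefschetz K) f) ∧
    a.degree < n ∧ b.degree < n ∧ f.Monic ∧ f.natDegree + 1 = n

theorem IsTatePair.swap {Φ Ψ : MvPolynomial ι K} {n : ℕ} (h : IsTatePair Φ Ψ n) :
    IsTatePair Ψ Φ n := by
  obtain ⟨a, b, f, h1, h2, h3, h4, h5, h6⟩ := h
  exact ⟨b, a, f, h2, h1, fiberLocus_swap h3, h5, h4, h6⟩

/-- Split `{Ψ ≠ 0}` by `Φ`: the closed part has class `a`, and scaling gives `(𝕃 - 1) f` for the
open part. -/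
theorem hasClass_isUnit_right [Finite ι] {Φ Ψ : MvPolynomial ι K} {ε : ℤ} (hs : Scales ε Φ Ψ)
    {a f : ℤ[X]} (ha : HasClass (basicLocus Φ Ψ) (aeval (lefschetz K) a))
    (hf : HasClass (fiberLocus Φ Ψ) (aeval (lefschetz K) f)) :
    HasClass (fun _ _ _ => {p | IsUnit (MvPolynomial.aeval p Ψ)})
      (aeval (lefschetz K) (a + (X - 1) * f)) := by
  have h1 := hs.hasClass_units hf
  -- With `f := 0` the vanishing condition is void.
  have h2 := hasClass_basicLocus_of_pieces (f := 0) (g := Ψ) Φ ha h1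
    (fun R _ _ p => by simp [basicLocus, and_comm]) (fun R _ _ p => by simp [and_comm])
  have h3 : aeval (lefschetz K) (a + (X - 1) * f) =
      aeval (lefschetz K) a + (lefschetz K - 1) * aeval (lefschetz K) f := by simp
  rw [h3]
  exact h2.congr fun R _ _ p => by simp [basicLocus]

theorem monic_add_X_sub_one_mul {a f : ℤ[X]} {n : ℕ} (ha : a.degree < n) (hf : f.Monic)
    (hn : f.natDegree + 1 = n) :
    (a + (X - 1) * f).Monic ∧ (a + (X - 1) * f).natDegree = n := by
  have h1 : ((X - 1 : ℤ[X]) * f).Monic := (monic_X_sub_C (1 : ℤ)).mul hf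
  have h2 : ((X - 1 : ℤ[X]) * f).natDegree = n := by
    have h3 : (X - 1 : ℤ[X]).natDegree = 1 := natDegree_X_sub_C (1 : ℤ)
    have h4 : (X - 1 : ℤ[X]).Monic := monic_X_sub_C (1 : ℤ)
    rw [h4.natDegree_mul hf, h3, add_comm, hn]
  have h5 : a.degree < ((X - 1 : ℤ[X]) * f).degree := by
    rwa [degree_eq_natDegree h1.ne_zero, h2]
  exact ⟨h1.add_of_right h5, (natDegree_add_eq_right_of_degree_lt h5).trans h2⟩

/-- The polynomial `Φ₁ Ψ₂ + Ψ₁ Φ₂` in two disjoint sets of variables. -/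
noncomputable def crossSum (Φ₁ Ψ₁ : MvPolynomial ι K) (Φ₂ Ψ₂ : MvPolynomial κ K) :
    MvPolynomial (ι ⊕ κ) K :=
  MvPolynomial.rename Sum.inl Φ₁ * MvPolynomial.rename Sum.inr Ψ₂ +
    MvPolynomial.rename Sum.inl Ψ₁ * MvPolynomial.rename Sum.inr Φ₂

/-- The polynomial `Ψ₁ Ψ₂` in two disjoint sets of variables. -/
noncomputable def crossMul (Ψ₁ : MvPolynomial ι K) (Ψ₂ : MvPolynomial κ K) :
    MvPolynomial (ι ⊕ κ) K :=
  MvPolynomial.rename Sum.inl Ψ₁ * MvPolynomial.rename Sum.inr Ψ₂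

theorem crossSum_swap (Φ₁ Ψ₁ : MvPolynomial ι K) (Φ₂ Ψ₂ : MvPolynomial κ K) :
    crossSum Φ₁ Ψ₁ Φ₂ Ψ₂ = crossSum Ψ₁ Φ₁ Ψ₂ Φ₂ := by
  rw [crossSum, crossSum, add_comm]

theorem aeval_crossSum (Φ₁ Ψ₁ : MvPolynomial ι K) (Φ₂ Ψ₂ : MvPolynomial κ K) {R : Type u}
    [CommRing R] [Algebra K R] (p : ι ⊕ κ → R) :
    MvPolynomial.aeval p (crossSum Φ₁ Ψ₁ Φ₂ Ψ₂) =
      MvPolynomial.aeval (p ∘ Sum.inl) Φ₁ * MvPolynomial.aeval (p ∘ Sum.inr) Ψ₂ +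
        MvPolynomial.aeval (p ∘ Sum.inl) Ψ₁ * MvPolynomial.aeval (p ∘ Sum.inr) Φ₂ := by
  simp [crossSum, MvPolynomial.aeval_rename]

theorem aeval_crossMul (Ψ₁ : MvPolynomial ι K) (Ψ₂ : MvPolynomial κ K) {R : Type u}
    [CommRing R] [Algebra K R] (p : ι ⊕ κ → R) :
    MvPolynomial.aeval p (crossMul Ψ₁ Ψ₂) =
      MvPolynomial.aeval (p ∘ Sum.inl) Ψ₁ * MvPolynomial.aeval (p ∘ Sum.inr) Ψ₂ := by
  simp [crossMul, MvPolynomial.aeval_rename]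

/-! ### Classes of a composition of two pairs -/

variable {Φ₁ Ψ₁ : MvPolynomial ι K} {Φ₂ Ψ₂ : MvPolynomial κ K} {ε : ℤ}

theorem Scales.cross (h₁ : Scales ε Φ₁ Ψ₁) (h₂ : Scales ε Φ₂ Ψ₂) :
    Scales ε (crossSum Φ₁ Ψ₁ Φ₂ Ψ₂) (crossMul Ψ₁ Ψ₂) := by
  intro R _ _ x p
  obtain ⟨y, h3, h4⟩ := h₁ R x (p ∘ Sum.inl)
  obtain ⟨z, h5, h6⟩ := h₂ R x (p ∘ Sum.inr)
  refine ⟨y * z, ?_, ?_⟩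
  · simp only [aeval_crossSum, Function.comp_def, Units.val_mul] at *
    rw [h3, h4, h5, h6]
    ring
  · simp only [aeval_crossMul, Function.comp_def, Units.val_mul] at *
    rw [h4, h6]
    ring

/-- Two ratios have sum zero when both vanish or when they are opposite units; the latter are
parametrized by the multiplicative group. -/
theorem hasClass_cross_zero [Finite ι] [Finite κ] (h₁ : Scales ε Φ₁ Ψ₁) (h₂ : Scales ε Φ₂ Ψ₂)
    {a₁ a₂ f₁ f₂ : GrothendieckRing K}
    (ha₁ : HasClass (basicLocus Φ₁ Ψ₁) a₁) (ha₂ : HasClass (basicLocus Φ₂ Ψ₂) a₂)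
    (hf₁ : HasClass (fiberLocus Φ₁ Ψ₁) f₁) (hf₂ : HasClass (fiberLocus Φ₂ Ψ₂) f₂) :
    HasClass (basicLocus (crossSum Φ₁ Ψ₁ Φ₂ Ψ₂) (crossMul Ψ₁ Ψ₂))
      (a₁ * a₂ + (lefschetz K - 1) * (f₁ * f₂)) := by
  refine hasClass_basicLocus_of_pieces (MvPolynomial.rename Sum.inl Φ₁) (ha₁.prod ha₂)
    (h₁.hasClass_ratio_add_eq h₂ hf₁ hf₂ 0 (hasClass_units.congr fun R _ _ p => by simp)) ?_ ?_
  all_goals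
    intro R _ _ p
    simp only [basicLocus, Set.mem_ofPred_eq, aeval_crossSum, aeval_crossMul,
      MvPolynomial.aeval_rename, IsUnit.mul_iff, Nat.cast_zero, zero_mul]
    generalize MvPolynomial.aeval (p ∘ Sum.inl) Φ₁ = A₁
    generalize MvPolynomial.aeval (p ∘ Sum.inl) Ψ₁ = B₁
    generalize MvPolynomial.aeval (p ∘ Sum.inr) Φ₂ = A₂
    generalize MvPolynomial.aeval (p ∘ Sum.inr) Ψ₂ = B₂
  · constructor
    · rintro ⟨⟨rfl, hB₁⟩, rfl, hB₂⟩
      simp [hB₁, hB₂]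
    · rintro ⟨⟨h, hB₁, hB₂⟩, rfl⟩
      rw [zero_mul, zero_add, hB₁.mul_right_eq_zero] at h
      exact ⟨⟨rfl, hB₁⟩, h, hB₂⟩
  · constructor
    · rintro ⟨⟨⟨hA₁, hB₁⟩, hA₂, hB₂⟩, h⟩
      exact ⟨⟨h, hB₁, hB₂⟩, hA₁⟩
    · rintro ⟨⟨h, hB₁, hB₂⟩, hA₁⟩
      have : IsUnit (B₁ * A₂) := by
        rw [← neg_eq_of_add_eq_zero_right h]
        exact (hA₁.mul hB₂).neg
      exact ⟨⟨⟨hA₁, hB₁⟩, (IsUnit.mul_iff.mp this).2, hB₂⟩, h⟩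

/-- Where `Ψ₁ = 0`, the sum is `Φ₁Ψ₂`, so `Φ₁` and `Ψ₂` are units. Where `Ψ₁` is a unit, `Ψ₂ = 0`
and the sum is `Ψ₁Φ₂`, so `Φ₂` is a unit. -/
theorem hasClass_cross_infty [Finite ι] [Finite κ]
    {b₁ b₂ u₁ u₂ : GrothendieckRing K}
    (hb₁ : HasClass (basicLocus Ψ₁ Φ₁) b₁) (hb₂ : HasClass (basicLocus Ψ₂ Φ₂) b₂)
    (hu₁ : HasClass (fun _ _ _ => {p | IsUnit (MvPolynomial.aeval p Ψ₁)}) u₁)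
    (hu₂ : HasClass (fun _ _ _ => {p | IsUnit (MvPolynomial.aeval p Ψ₂)}) u₂) :
    HasClass (basicLocus (crossMul Ψ₁ Ψ₂) (crossSum Φ₁ Ψ₁ Φ₂ Ψ₂)) (b₁ * u₂ + u₁ * b₂) := by
  refine hasClass_basicLocus_of_pieces (MvPolynomial.rename Sum.inl Ψ₁) (hb₁.prod hu₂)
    (hu₁.prod hb₂) ?_ ?_
  all_goals
    intro R _ _ p
    simp only [basicLocus, Set.mem_ofPred_eq, aeval_crossSum, aeval_crossMul,
      MvPolynomial.aeval_rename]
    generalize MvPolynomial.aeval (p ∘ Sum.inl) Φ₁ = A₁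
    generalize MvPolynomial.aeval (p ∘ Sum.inl) Ψ₁ = B₁
    generalize MvPolynomial.aeval (p ∘ Sum.inr) Φ₂ = A₂
    generalize MvPolynomial.aeval (p ∘ Sum.inr) Ψ₂ = B₂
  · constructor
    · rintro ⟨⟨rfl, hA₁⟩, hB₂⟩
      simp [hA₁, hB₂]
    · rintro ⟨⟨-, h⟩, rfl⟩
      rw [zero_mul, add_zero, IsUnit.mul_iff] at h
      exact ⟨⟨rfl, h.1⟩, h.2⟩
  · constructor
    · rintro ⟨hB₁, rfl, hA₂⟩
      simp [hB₁, hA₂]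
    · rintro ⟨⟨h, h'⟩, hB₁⟩
      rw [hB₁.mul_right_eq_zero] at h
      rw [h, mul_zero, zero_add, IsUnit.mul_iff] at h'
      exact ⟨hB₁, h, h'.2⟩

/-- Two ratios have sum one when they are `(0, 1)`, `(1, 0)` or `(x, 1 - x)` with both entries
units; the last case is parametrized by the line without `0` and `1`. -/
theorem hasClass_cross_one [Finite ι] [Finite κ] (h₁ : Scales ε Φ₁ Ψ₁) (h₂ : Scales ε Φ₂ Ψ₂)
    {a₁ a₂ f₁ f₂ : GrothendieckRing K}
    (ha₁ : HasClass (basicLocus Φ₁ Ψ₁) a₁) (ha₂ : HasClass (basicLocus Φ₂ Ψ₂) a₂)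
    (hf₁ : HasClass (fiberLocus Φ₁ Ψ₁) f₁) (hf₂ : HasClass (fiberLocus Φ₂ Ψ₂) f₂) :
    HasClass (fiberLocus (crossSum Φ₁ Ψ₁ Φ₂ Ψ₂) (crossMul Ψ₁ Ψ₂))
      (a₁ * f₂ + (f₁ * a₂ + (lefschetz K - 2) * (f₁ * f₂))) := by
  -- The part where the first ratio is a unit, cut further according to whether the second one
  -- vanishes or is a unit.
  have key : HasClass (basicLocus (crossSum Φ₁ Ψ₁ Φ₂ Ψ₂ - crossMul Ψ₁ Ψ₂)
      (crossMul Ψ₁ Ψ₂ * MvPolynomial.rename Sum.inl Φ₁))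
      (f₁ * a₂ + (lefschetz K - 2) * (f₁ * f₂)) := by
    refine hasClass_basicLocus_of_pieces (MvPolynomial.rename Sum.inr Φ₂) (hf₁.prod ha₂)
      (h₁.hasClass_ratio_add_eq h₂ hf₁ hf₂ 1
        (hasClass_units_sub_one.congr fun R _ _ p => by simp)) ?_ ?_
    all_goals
      intro R _ _ p
      simp only [fiberLocus, basicLocus, Set.mem_ofPred_eq, map_sub, map_mul, aeval_crossSum,
        aeval_crossMul, MvPolynomial.aeval_rename, IsUnit.mul_iff, Nat.cast_one, one_mul,
        sub_eq_zero]
      generalize MvPolynomial.aeval (p ∘ Sum.inl) Φ₁ = A₁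
      generalize MvPolynomial.aeval (p ∘ Sum.inl) Ψ₁ = B₁
      generalize MvPolynomial.aeval (p ∘ Sum.inr) Φ₂ = A₂
      generalize MvPolynomial.aeval (p ∘ Sum.inr) Ψ₂ = B₂
    · constructor
      · rintro ⟨⟨rfl, hB₁⟩, rfl, hB₂⟩
        simp [hB₁, hB₂]
      · rintro ⟨⟨h, ⟨hB₁, hB₂⟩, -⟩, rfl⟩
        rw [mul_zero, add_zero, hB₂.mul_left_inj] at h
        exact ⟨⟨h, hB₁⟩, rfl, hB₂⟩
    · tauto
  have h := hasClass_basicLocus_of_pieces (f := crossSum Φ₁ Ψ₁ Φ₂ Ψ₂ - crossMul Ψ₁ Ψ₂)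
    (g := crossMul Ψ₁ Ψ₂) (MvPolynomial.rename Sum.inl Φ₁) (ha₁.prod hf₂) key
    (fun R _ _ p => ?_) (fun R _ _ p => ?_)
  · exact h.congr fun R _ _ p => by simp [basicLocus, fiberLocus, sub_eq_zero]
  · simp only [fiberLocus, basicLocus, Set.mem_ofPred_eq, map_sub, aeval_crossSum,
      aeval_crossMul, MvPolynomial.aeval_rename, IsUnit.mul_iff, sub_eq_zero]
    generalize MvPolynomial.aeval (p ∘ Sum.inl) Φ₁ = A₁
    generalize MvPolynomial.aeval (p ∘ Sum.inl) Ψ₁ = B₁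
    generalize MvPolynomial.aeval (p ∘ Sum.inr) Φ₂ = A₂
    generalize MvPolynomial.aeval (p ∘ Sum.inr) Ψ₂ = B₂
    constructor
    · rintro ⟨⟨rfl, hB₁⟩, rfl, hB₂⟩
      simp [hB₁, hB₂]
    · rintro ⟨⟨h, hB₁, hB₂⟩, rfl⟩
      rw [zero_mul, zero_add, hB₁.mul_right_inj] at h
      exact ⟨⟨rfl, hB₁⟩, h, hB₂⟩
  · simp [basicLocus, and_assoc]

theorem degree_mul_lt_add {p q : ℤ[X]} {m n : ℕ} (hp : p.degree < m) (hq : q.degree ≤ n) :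
    (p * q).degree < ((m + n : ℕ) : WithBot ℕ) := by
  rcases eq_or_ne p 0 with rfl | hp0
  · simp
  rcases eq_or_ne q 0 with rfl | hq0
  · simp
  rw [degree_eq_natDegree hp0, Nat.cast_lt] at hp
  rw [degree_eq_natDegree hq0, Nat.cast_le] at hq
  rw [degree_mul, degree_eq_natDegree hp0, degree_eq_natDegree hq0, ← Nat.cast_add, Nat.cast_lt]
  omega

theorem IsTatePair.cross [Finite ι] [Finite κ] (h₁ : Scales ε Φ₁ Ψ₁) (h₂ : Scales ε Φ₂ Ψ₂)
    {n₁ n₂ : ℕ} (ht₁ : IsTatePair Φ₁ Ψ₁ n₁) (ht₂ : IsTatePair Φ₂ Ψ₂ n₂) :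
    IsTatePair (crossSum Φ₁ Ψ₁ Φ₂ Ψ₂) (crossMul Ψ₁ Ψ₂) (n₁ + n₂) := by
  obtain ⟨a₁, b₁, f₁, ha₁, hb₁, hf₁, da₁, db₁, mf₁, df₁⟩ := ht₁
  obtain ⟨a₂, b₂, f₂, ha₂, hb₂, hf₂, da₂, db₂, mf₂, df₂⟩ := ht₂
  have hu₁ := hasClass_isUnit_right h₁ ha₁ hf₁
  have hu₂ := hasClass_isUnit_right h₂ ha₂ hf₂
  have du₁ := monic_add_X_sub_one_mul da₁ mf₁ df₁
  have du₂ := monic_add_X_sub_one_mul da₂ mf₂ df₂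
  have mff : (f₁ * f₂).Monic := mf₁.mul mf₂
  have dff : (f₁ * f₂).natDegree + 2 = n₁ + n₂ := by rw [mf₁.natDegree_mul mf₂]; omega
  -- `k = 1` occurs in the new `a`, and `k = 2` in the new `f`.
  have mX (k : ℤ) : ((X - C k) * (f₁ * f₂)).Monic ∧
      ((X - C k) * (f₁ * f₂)).natDegree + 1 = n₁ + n₂ := by
    refine ⟨(monic_X_sub_C k).mul mff, ?_⟩
    rw [(monic_X_sub_C k).natDegree_mul mff, natDegree_X_sub_C]
    omega
  have eX (k : ℤ) : ((X - C k) * (f₁ * f₂)).degree < ((n₁ + n₂ : ℕ) : WithBot ℕ) := by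
    rw [degree_eq_natDegree (mX k).1.ne_zero, Nat.cast_lt, ← (mX k).2]; omega
  refine ⟨a₁ * a₂ + (X - C 1) * (f₁ * f₂),
    b₁ * (a₂ + (X - 1) * f₂) + (a₁ + (X - 1) * f₁) * b₂,
    a₁ * f₂ + (f₁ * a₂ + (X - C 2) * (f₁ * f₂)), ?_, ?_, ?_, ?_, ?_, ?_⟩
  · simpa using hasClass_cross_zero h₁ h₂ ha₁ ha₂ hf₁ hf₂
  · simpa using hasClass_cross_infty hb₁ hb₂ hu₁ hu₂
  · have h2 : aeval (lefschetz K) (2 : ℤ[X]) = 2 := map_ofNat _ 2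
    simpa [h2] using hasClass_cross_one h₁ h₂ ha₁ ha₂ hf₁ hf₂
  · exact (degree_add_le _ _).trans_lt (max_lt (degree_mul_lt_add da₁ da₂.le) (eX 1))
  · refine (degree_add_le _ _).trans_lt (max_lt (degree_mul_lt_add db₁ ?_) ?_)
    · rw [degree_eq_natDegree du₂.1.ne_zero, du₂.2]
    · rw [mul_comm, add_comm n₁]
      refine degree_mul_lt_add db₂ ?_
      rw [degree_eq_natDegree du₁.1.ne_zero, du₁.2]
  -- Only `(X - 2) f₁f₂` reaches degree `n₁ + n₂ - 1`, so it alone decides the leading coefficient.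
  · have h3 : (a₁ * f₂).degree < ((X - C 2) * (f₁ * f₂)).degree := by
      rw [degree_eq_natDegree (mX 2).1.ne_zero]
      have : ((X - C 2) * (f₁ * f₂)).natDegree = n₁ + f₂.natDegree := by
        have := (mX 2).2; omega
      rw [this]
      exact degree_mul_lt_add da₁ degree_le_natDegree
    have h4 : (f₁ * a₂).degree < ((X - C 2) * (f₁ * f₂)).degree := by
      rw [degree_eq_natDegree (mX 2).1.ne_zero]
      have : ((X - C 2) * (f₁ * f₂)).natDegree = n₂ + f₁.natDegree := by
        have := (mX 2).2; omega
      rw [this, mul_comm]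
      exact degree_mul_lt_add da₂ degree_le_natDegree
    rw [← add_assoc]
    have h5 := (degree_add_le (a₁ * f₂) (f₁ * a₂)).trans_lt (max_lt h3 h4)
    exact ⟨(mX 2).1.add_of_right h5, by rw [natDegree_add_eq_right_of_degree_lt h5, (mX 2).2]⟩

/-- The pair of a single edge. -/
theorem isTatePair_X_one : IsTatePair (MvPolynomial.X PUnit.unit : MvPolynomial PUnit K) 1 1 := by
  refine ⟨1, 0, 1, ?_, ?_, ?_, ?_, ?_, monic_one, by simp⟩
  · rw [map_one]
    exact hasClass_origin.congr fun R _ _ p => by simp [basicLocus]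
  · have h : HasClass (basicLocus (1 : MvPolynomial PUnit K) (MvPolynomial.X PUnit.unit))
        (0 : GrothendieckRing K) := by
      -- The condition `1 = 0` does have points over the zero ring, so the locus is not empty as a
      -- functor. Cutting the multiplicative group by the polynomial `1` leaves all of it as the
      -- open part, which forces class `0` for the closed part.
      obtain ⟨c₀, c₁, h₀, h₁, h⟩ := (hasClass_units (K := K)).exists_eq_add 1
      have := (h₁.congr (S' := fun _ _ _ => {p | IsUnit (p PUnit.unit)})
        fun R _ _ p => by simp).unique hasClass_units
      rw [← this] at h
      rw [left_eq_add.mp (h.trans (add_comm _ _))] at h₀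
      exact h₀.congr fun R _ _ p => by simp [basicLocus, and_comm]
    rwa [map_zero]
  · rw [map_one]
    exact (hasClass_point 1).congr fun R _ _ p => by simp [fiberLocus]
  · rw [degree_one]; exact_mod_cast Nat.one_pos
  · simp

theorem scales_X_one : Scales 1 (MvPolynomial.X PUnit.unit : MvPolynomial PUnit K) 1 := by
  intro R _ _ x p
  exact ⟨1, by simp [unitZPow_coe]⟩

theorem IsTatePair.reindex (e : ι ≃ κ) {Φ Ψ : MvPolynomial ι K} {n : ℕ} (h : IsTatePair Φ Ψ n) :
    IsTatePair (MvPolynomial.rename e Φ) (MvPolynomial.rename e Ψ) n := by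
  obtain ⟨a, b, f, h1, h2, h3, h4⟩ := h
  refine ⟨a, b, f, ?_, ?_, ?_, h4⟩
  · exact (h1.reindex e.symm).congr fun R _ _ p => by simp [basicLocus, MvPolynomial.aeval_rename]
  · exact (h2.reindex e.symm).congr fun R _ _ p => by simp [basicLocus, MvPolynomial.aeval_rename]
  · exact (h3.reindex e.symm).congr fun R _ _ p => by simp [fiberLocus, MvPolynomial.aeval_rename]

theorem Scales.reindex (e : ι ≃ κ) {Φ Ψ : MvPolynomial ι K} (h : Scales ε Φ Ψ) :
    Scales ε (MvPolynomial.rename e Φ) (MvPolynomial.rename e Ψ) := by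
  intro R _ _ x p
  simp only [MvPolynomial.aeval_rename]
  exact h R x (p ∘ e)

end TatePair

/-! ### Polynomials of families of finite sets -/

section MinimalPolynomial

variable {K : Type u} [Field K] {ι κ : Type u}

open Classical in
/-- The sum, over the minimal sets of the family `C`, of the monomials that are the products of the
variables outside the set. -/
noncomputable def minimalPoly (K : Type u) [Field K] {ι : Type*} [Fintype ι]
    (C : Set (Finset ι)) : MvPolynomial ι K :=
  ∑ T ∈ (Finset.univ : Finset (Finset ι)).filter (Minimal (· ∈ C)), ∏ e ∈ Tᶜ, MvPolynomial.X e

theorem minimalPoly_eq_prod [Fintype ι] {C : Set (Finset ι)} {S S' : Finset ι}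
    (h : ∀ T, Minimal (· ∈ C) T ↔ T = S) (hS : ∀ e, e ∈ S' ↔ e ∉ S) :
    minimalPoly K C = ∏ e ∈ S', MvPolynomial.X e := by
  classical
  rw [minimalPoly, Finset.filter_congr fun T _ => h T, Finset.filter_eq',
    if_pos (Finset.mem_univ _), Finset.sum_singleton]
  exact Finset.prod_congr (by ext e; simp [hS]) fun _ _ => rfl

/-- The family of the disjoint unions of a set of `A` and a set of `B`. -/
def unionFamily (A : Set (Finset ι)) (B : Set (Finset κ)) : Set (Finset (ι ⊕ κ)) :=
  {T | T.toLeft ∈ A ∧ T.toRight ∈ B}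

theorem minimal_unionFamily (A : Set (Finset ι)) (B : Set (Finset κ)) (T : Finset (ι ⊕ κ)) :
    Minimal (· ∈ unionFamily A B) T ↔
      Minimal (· ∈ A) T.toLeft ∧ Minimal (· ∈ B) T.toRight := by
  constructor
  · rintro ⟨⟨hA, hB⟩, h⟩
    refine ⟨⟨hA, fun S hS hST => ?_⟩, hB, fun S hS hST => ?_⟩
    · have := h (y := S.disjSum T.toRight) (by simp [unionFamily, hS, hB])
        (Finset.disjSum_subset.mpr ⟨hST, subset_rfl⟩)
      exact (Finset.subset_disjSum.mp this).1
    · have := h (y := T.toLeft.disjSum S) (by simp [unionFamily, hS, hA])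
        (Finset.disjSum_subset.mpr ⟨subset_rfl, hST⟩)
      exact (Finset.subset_disjSum.mp this).2
  · rintro ⟨⟨hA, hA'⟩, hB, hB'⟩
    refine ⟨⟨hA, hB⟩, fun S hS hST => ?_⟩
    have h1 := hA' hS.1 (Finset.toLeft_subset_toLeft hST)
    have h2 := hB' hS.2 (Finset.toRight_subset_toRight hST)
    rw [← Finset.toLeft_disjSum_toRight (u := T)]
    exact Finset.disjSum_subset.mpr ⟨h1, h2⟩

theorem minimalPoly_unionFamily [Fintype ι] [Fintype κ] (A : Set (Finset ι)) (B : Set (Finset κ)) :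
    minimalPoly K (unionFamily A B) = crossMul (minimalPoly K A) (minimalPoly K B) := by
  classical
  simp only [minimalPoly, crossMul, map_sum, map_prod, MvPolynomial.rename_X]
  rw [Finset.sum_mul_sum, ← Finset.sum_product']
  refine Finset.sum_equiv Finset.sumEquiv.toEquiv (fun T => ?_) (fun T _ => ?_)
  · simp [minimal_unionFamily]
  · have : ∀ S : Finset (ι ⊕ κ), (∀ e, e ∈ S ↔ e ∉ T) → S = (T.toLeftᶜ).disjSum (T.toRightᶜ) := by
      intro S hS
      ext (i | i) <;> simp [hS]
    refine (Finset.prod_congr (this _ fun _ => by simp) fun _ _ => rfl).trans ?_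
    exact Finset.prod_disjSum _ _ _

/-- Every set of `C` lies in `D` and properly contains a set of `D`. -/
def IsStrictPair (C D : Set (Finset ι)) : Prop :=
  C ⊆ D ∧ ∀ T ∈ C, ∃ S ∈ D, S < T

/-- The family of the disjoint unions of a set of `C₁` and a set of `D₂`, or of a set of `D₁` and
a set of `C₂`. -/
def crossFamily (C₁ D₁ : Set (Finset ι)) (C₂ D₂ : Set (Finset κ)) : Set (Finset (ι ⊕ κ)) :=
  unionFamily C₁ D₂ ∪ unionFamily D₁ C₂

variable {C₁ D₁ : Set (Finset ι)} {C₂ D₂ : Set (Finset κ)}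

/-- For networks `C` is `spanningFamily E {s}` and `D` is `spanningFamily E {s, t}`: a set that
connects everything is never a minimal set for two roots. This keeps the two kinds of terms in a
cross sum apart. -/
theorem IsStrictPair.not_minimal {C D : Set (Finset ι)} (h : IsStrictPair C D) {T : Finset ι}
    (hT : T ∈ C) : ¬ Minimal (· ∈ D) T := by
  obtain ⟨S, hS, hST⟩ := h.2 T hT
  exact fun hm => hm.not_prop_of_lt hST hS

/-- A set of one union inside a minimal set of the other would have a component in `C` lying inside
a minimal set of `D`, hence equal to it, against strictness. -/
theorem minimal_crossFamily (h₁ : IsStrictPair C₁ D₁) (h₂ : IsStrictPair C₂ D₂)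
    (T : Finset (ι ⊕ κ)) :
    Minimal (· ∈ crossFamily C₁ D₁ C₂ D₂) T ↔
      Minimal (· ∈ unionFamily C₁ D₂) T ∨ Minimal (· ∈ unionFamily D₁ C₂) T := by
  constructor
  · rintro ⟨hT | hT, h⟩
    · exact Or.inl ⟨hT, fun S hS => h (Or.inl hS)⟩
    · exact Or.inr ⟨hT, fun S hS => h (Or.inr hS)⟩
  · rintro (hT | hT)
    · refine ⟨Or.inl hT.1, ?_⟩
      rintro S (hS | hS) hST
      · exact hT.2 hS hST
      · have h := ((minimal_unionFamily _ _ _).mp hT).2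
        have hR : S.toRight = T.toRight :=
          have hle := Finset.toRight_subset_toRight hST
          hle.antisymm (h.2 (h₂.1 hS.2) hle)
        exact absurd h (h₂.not_minimal (hR ▸ hS.2))
    · refine ⟨Or.inr hT.1, ?_⟩
      rintro S (hS | hS) hST
      · have h := ((minimal_unionFamily _ _ _).mp hT).1
        have hL : S.toLeft = T.toLeft :=
          have hle := Finset.toLeft_subset_toLeft hST
          hle.antisymm (h.2 (h₁.1 hS.1) hle)
        exact absurd h (h₁.not_minimal (hL ▸ hS.1))
      · exact hT.2 hS hST

/-- The minimal sets of the two unions are disjoint and together are those of the cross family, so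
the sum splits into two products. -/
theorem minimalPoly_crossFamily [Fintype ι] [Fintype κ] (h₁ : IsStrictPair C₁ D₁)
    (h₂ : IsStrictPair C₂ D₂) :
    minimalPoly K (crossFamily C₁ D₁ C₂ D₂) = crossSum (minimalPoly K D₁) (minimalPoly K C₁)
      (minimalPoly K D₂) (minimalPoly K C₂) := by
  classical
  rw [crossSum, ← crossMul, ← crossMul, ← minimalPoly_unionFamily, ← minimalPoly_unionFamily,
    add_comm]
  simp only [minimalPoly]
  rw [← Finset.sum_union]
  · refine Finset.sum_congr ?_ fun _ _ => rfl
    ext T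
    simp [minimal_crossFamily h₁ h₂]
  · refine Finset.disjoint_filter.mpr fun T _ hT hT' => ?_
    rw [minimal_unionFamily] at hT hT'
    exact h₁.not_minimal hT.1.1 hT'.1

theorem lt_of_toLeft_lt {S T : Finset (ι ⊕ κ)} (h : S ≤ T) (h' : S.toLeft < T.toLeft) : S < T :=
  lt_of_le_of_ne h fun e => h'.ne (e ▸ rfl)

theorem exists_lt_toLeft {T : Finset (ι ⊕ κ)} {S : Finset ι} (h : S < T.toLeft) :
    S.disjSum T.toRight < T := by
  refine lt_of_toLeft_lt ?_ (by simpa using h)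
  nth_rw 2 [← Finset.toLeft_disjSum_toRight (u := T)]
  exact Finset.disjSum_mono h.le le_rfl

theorem IsStrictPair.series (h₁ : IsStrictPair C₁ D₁) (h₂ : IsStrictPair C₂ D₂) :
    IsStrictPair (unionFamily C₁ C₂) (crossFamily C₁ D₁ C₂ D₂) := by
  refine ⟨fun T hT => Or.inl ⟨hT.1, h₂.1 hT.2⟩, fun T hT => ?_⟩
  obtain ⟨S, hS, hST⟩ := h₁.2 _ hT.1
  exact ⟨_, Or.inr (by simp [unionFamily, hS, hT.2]), exists_lt_toLeft hST⟩

theorem exists_lt_toRight {T : Finset (ι ⊕ κ)} {S : Finset κ} (h : S < T.toRight) :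
    T.toLeft.disjSum S < T := by
  refine lt_of_le_of_ne ?_ fun e => h.ne (by rw [← e]; simp)
  nth_rw 2 [← Finset.toLeft_disjSum_toRight (u := T)]
  exact Finset.disjSum_mono le_rfl h.le

theorem IsStrictPair.parallel (h₁ : IsStrictPair C₁ D₁) (h₂ : IsStrictPair C₂ D₂) :
    IsStrictPair (crossFamily C₁ D₁ C₂ D₂) (unionFamily D₁ D₂) := by
  constructor
  · rintro T (hT | hT)
    · exact ⟨h₁.1 hT.1, hT.2⟩
    · exact ⟨hT.1, h₂.1 hT.2⟩
  · rintro T (hT | hT)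
    · obtain ⟨S, hS, hST⟩ := h₁.2 _ hT.1
      exact ⟨_, by simp [unionFamily, hS, hT.2], exists_lt_toLeft hST⟩
    · obtain ⟨S, hS, hST⟩ := h₂.2 _ hT.2
      exact ⟨_, by simp [unionFamily, hS, hT.1], exists_lt_toRight hST⟩

theorem minimal_map_iff (e : ι ≃ κ) {A : Set (Finset ι)} {B : Set (Finset κ)}
    (h : ∀ T, T ∈ A ↔ T.map e.toEmbedding ∈ B) (T : Finset ι) :
    Minimal (· ∈ A) T ↔ Minimal (· ∈ B) (T.map e.toEmbedding) := by
  constructor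
  · rintro ⟨hT, hm⟩
    refine ⟨(h T).mp hT, fun S hS hST => ?_⟩
    have hS' : (S.map e.symm.toEmbedding).map e.toEmbedding = S := by
      ext; simp
    have := hm (y := S.map e.symm.toEmbedding) ((h _).mpr (by rwa [hS']))
      (Finset.map_subset_map (f := e.toEmbedding).mp (by rwa [hS']))
    have := Finset.map_subset_map (f := e.toEmbedding).mpr this
    rwa [hS'] at this
  · rintro ⟨hT, hm⟩
    exact ⟨(h T).mpr hT, fun S hS hST => Finset.map_subset_map.mp
      (hm ((h S).mp hS) (Finset.map_subset_map.mpr hST))⟩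

theorem minimalPoly_reindex [Fintype ι] [Fintype κ] (e : ι ≃ κ) {A : Set (Finset ι)}
    {B : Set (Finset κ)} (h : ∀ T, T ∈ A ↔ T.map e.toEmbedding ∈ B) :
    minimalPoly K A = MvPolynomial.rename e.symm (minimalPoly K B) := by
  classical
  simp only [minimalPoly, map_sum, map_prod, MvPolynomial.rename_X]
  refine Finset.sum_equiv e.finsetCongr (fun T => ?_) (fun T _ => ?_)
  · simp [minimal_map_iff e h]
  · refine Finset.prod_equiv e (fun i => by simp) (fun i _ => by simp)

theorem IsStrictPair.reindex (e : ι ≃ κ) {A A' : Set (Finset ι)} {B B' : Set (Finset κ)}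
    (h : ∀ T, T ∈ A ↔ T.map e.toEmbedding ∈ B) (h' : ∀ T, T ∈ A' ↔ T.map e.toEmbedding ∈ B')
    (hB : IsStrictPair B B') : IsStrictPair A A' := by
  refine ⟨fun T hT => (h' T).mpr (hB.1 ((h T).mp hT)), fun T hT => ?_⟩
  obtain ⟨S, hS, hST⟩ := hB.2 _ ((h T).mp hT)
  have hS' : (S.map e.symm.toEmbedding).map e.toEmbedding = S := by
    ext; simp
  refine ⟨S.map e.symm.toEmbedding, (h' _).mpr (by rwa [hS']), ?_⟩
  rw [← hS'] at hST
  exact Finset.map_ssubset_map.mp hST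

end MinimalPolynomial

/-! ### Series-parallel networks -/

section Network

variable {ι κ : Type u}

/-- The ends of a family of edges. -/
def endVertices (E : ι → MelonicEdge) : Set ℕ :=
  {x | ∃ i, x = (E i).source ∨ x = (E i).target}

/-- No edge of `T` leaves the set of vertices `U`. -/
def NoEdgeLeaves (E : ι → MelonicEdge) (T : Finset ι) (U : Set ℕ) : Prop :=
  ∀ i ∈ T, (E i).source ∈ U ↔ (E i).target ∈ U

/-- The sets of edges that join every vertex to a vertex of `A`. -/
def spanningFamily (E : ι → MelonicEdge) (A : Set ℕ) : Set (Finset ι) :=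
  {T | ∀ U, A ⊆ U → NoEdgeLeaves E T U → endVertices E ⊆ U}

theorem spanningFamily_mono (E : ι → MelonicEdge) {A B : Set ℕ} (h : A ⊆ B) :
    spanningFamily E A ⊆ spanningFamily E B :=
  fun _ hT U hU => hT U (h.trans hU)

theorem source_mem_endVertices (E : ι → MelonicEdge) (i : ι) : (E i).source ∈ endVertices E :=
  ⟨i, Or.inl rfl⟩

theorem target_mem_endVertices (E : ι → MelonicEdge) (i : ι) : (E i).target ∈ endVertices E :=
  ⟨i, Or.inr rfl⟩

theorem NoEdgeLeaves.compl {E : ι → MelonicEdge} {T : Finset ι} {U : Set ℕ}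
    (h : NoEdgeLeaves E T U) : NoEdgeLeaves E T Uᶜ := fun i hi => not_congr (h i hi)

theorem noEdgeLeaves_univ (E : ι → MelonicEdge) (T : Finset ι) : NoEdgeLeaves E T Set.univ :=
  fun _ _ => Iff.rfl

variable {E : ι → MelonicEdge} {F : κ → MelonicEdge}

theorem endVertices_sumElim : endVertices (Sum.elim E F) = endVertices E ∪ endVertices F := by
  ext x
  simp [endVertices]

theorem noEdgeLeaves_sumElim {T : Finset (ι ⊕ κ)} {U : Set ℕ} :
    NoEdgeLeaves (Sum.elim E F) T U ↔
      NoEdgeLeaves E T.toLeft U ∧ NoEdgeLeaves F T.toRight U := by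
  simp [NoEdgeLeaves]

/-- Cuts of the two networks that agree on the common vertices are restrictions of one cut of the
union. This replaces any cutting and joining of paths. -/
theorem exists_glue {T : Finset (ι ⊕ κ)} {U₁ U₂ : Set ℕ} (h₁ : NoEdgeLeaves E T.toLeft U₁)
    (h₂ : NoEdgeLeaves F T.toRight U₂)
    (h : ∀ x ∈ endVertices E, x ∈ endVertices F → (x ∈ U₁ ↔ x ∈ U₂)) :
    ∃ U, NoEdgeLeaves (Sum.elim E F) T U ∧ (∀ x ∈ endVertices E, x ∈ U ↔ x ∈ U₁) ∧
      ∀ x ∈ endVertices F, x ∈ U ↔ x ∈ U₂ := by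
  have hE : ∀ x ∈ endVertices E,
      x ∈ (U₁ ∩ endVertices E) ∪ (U₂ ∩ endVertices F) ↔ x ∈ U₁ := by
    intro x hx
    have := h x hx
    simp only [Set.mem_union, Set.mem_inter_iff]
    tauto
  have hF : ∀ x ∈ endVertices F,
      x ∈ (U₁ ∩ endVertices E) ∪ (U₂ ∩ endVertices F) ↔ x ∈ U₂ := by
    intro x hx
    have := fun hx' => h x hx' hx
    simp only [Set.mem_union, Set.mem_inter_iff]
    tauto
  refine ⟨_, noEdgeLeaves_sumElim.mpr ⟨fun i hi => ?_, fun i hi => ?_⟩, hE, hF⟩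
  · rw [hE _ (source_mem_endVertices E i), hE _ (target_mem_endVertices E i)]
    exact h₁ i hi
  · rw [hF _ (source_mem_endVertices F i), hF _ (target_mem_endVertices F i)]
    exact h₂ i hi

theorem notMem_spanningFamily {A : Set ℕ} {T : Finset ι} :
    T ∉ spanningFamily E A ↔ ∃ U, A ⊆ U ∧ NoEdgeLeaves E T U ∧ ∃ x ∈ endVertices E, x ∉ U := by
  simp [spanningFamily, Set.not_subset]

/-- A cut of `E` that contains `B` extends by all vertices of `F`, because the common vertices lie
in `B`. -/
theorem toLeft_mem_spanningFamily {A B : Set ℕ} {T : Finset (ι ⊕ κ)}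
    (hT : T ∈ spanningFamily (Sum.elim E F) A)
    (hA : ∀ x ∈ A, x ∈ endVertices F ∨ x ∈ B ∧ x ∈ endVertices E)
    (h : ∀ x ∈ endVertices E, x ∈ endVertices F → x ∈ B) :
    T.toLeft ∈ spanningFamily E B := by
  intro U₁ hB hU₁ x hx
  obtain ⟨U, hU, hE, hF⟩ := exists_glue hU₁ (noEdgeLeaves_univ F T.toRight)
    fun x hx hx' => iff_of_true (hB (h x hx hx')) trivial
  rw [← hE x hx]
  refine hT U (fun y hy => ?_) hU (endVertices_sumElim.ge (Or.inl hx))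
  obtain hy | ⟨hy, hy'⟩ := hA y hy
  · exact (hF y hy).mpr trivial
  · exact (hE y hy').mpr (hB hy)

theorem toRight_mem_spanningFamily {A B : Set ℕ} {T : Finset (ι ⊕ κ)}
    (hT : T ∈ spanningFamily (Sum.elim E F) A)
    (hA : ∀ x ∈ A, x ∈ endVertices E ∨ x ∈ B ∧ x ∈ endVertices F)
    (h : ∀ x ∈ endVertices E, x ∈ endVertices F → x ∈ B) :
    T.toRight ∈ spanningFamily F B := by
  intro U₂ hB hU₂ x hx
  obtain ⟨U, hU, hE, hF⟩ := exists_glue (noEdgeLeaves_univ E T.toLeft) hU₂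
    fun x hx hx' => iff_of_true trivial (hB (h x hx hx'))
  rw [← hF x hx]
  refine hT U (fun y hy => ?_) hU (endVertices_sumElim.ge (Or.inr hx))
  obtain hy | ⟨hy, hy'⟩ := hA y hy
  · exact (hE y hy).mpr trivial
  · exact (hF y hy').mpr (hB hy)

variable {s t m : ℕ}

theorem spanningFamily_series (hs : s ∈ endVertices E) (hm : m ∈ endVertices E)
    (h : ∀ x ∈ endVertices E, x ∈ endVertices F → x = m) :
    spanningFamily (Sum.elim E F) {s} =
      unionFamily (spanningFamily E {s}) (spanningFamily F {m}) := by
  ext T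
  constructor
  · refine fun hT => ⟨fun U₁ hsU hU₁ x hx => ?_,
      toRight_mem_spanningFamily hT (by simp [hs]) (by simpa using h)⟩
    -- The cut on `F` is everything or nothing, according to the side of `m`.
    obtain ⟨U, hU, hE, hF⟩ := exists_glue (U₂ := {_x | m ∈ U₁}) hU₁ (fun _ _ => Iff.rfl)
      fun x hx hx' => by simp [h x hx hx']
    rw [← hE x hx]
    refine hT U ?_ hU (endVertices_sumElim.ge (Or.inl hx))
    rw [Set.singleton_subset_iff] at hsU ⊢
    exact (hE s hs).mpr hsU
  · rintro ⟨hL, hR⟩ U hsU hU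
    rw [noEdgeLeaves_sumElim] at hU
    rw [endVertices_sumElim]
    have h1 := hL U hsU hU.1
    exact Set.union_subset h1 (hR U (Set.singleton_subset_iff.mpr (h1 hm)) hU.2)

/-- The middle vertex `m` must be joined to `s` within `E` or to `t` within `F`; the side where this
happens is connected, and the other one needs only to be spanned from its two terminals. -/
theorem spanningFamily_series_pair (hs : s ∈ endVertices E) (hm : m ∈ endVertices E)
    (hm' : m ∈ endVertices F) (ht : t ∈ endVertices F)
    (h : ∀ x ∈ endVertices E, x ∈ endVertices F → x = m) :
    spanningFamily (Sum.elim E F) {s, t} =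
      crossFamily (spanningFamily E {s}) (spanningFamily E {s, m}) (spanningFamily F {m})
        (spanningFamily F {m, t}) := by
  ext T
  constructor
  · intro hT
    have hL : T.toLeft ∈ spanningFamily E {s, m} :=
      toLeft_mem_spanningFamily hT (by simp [hs, ht]) fun x hx hx' => by simp [h x hx hx']
    have hR : T.toRight ∈ spanningFamily F {m, t} :=
      toRight_mem_spanningFamily hT (by simp [hs, ht]) fun x hx hx' => by simp [h x hx hx']
    by_contra hn
    have hL' : T.toLeft ∉ spanningFamily E {s} := fun hL' => hn (Or.inl ⟨hL', hR⟩)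
    have hR' : T.toRight ∉ spanningFamily F {m} := fun hR' => hn (Or.inr ⟨hL, hR'⟩)
    obtain ⟨U₁, hsU₁, hU₁, x, hx, hxU₁⟩ := notMem_spanningFamily.mp hL'
    obtain ⟨U₂, hmU₂, hU₂, y, hy, hyU₂⟩ := notMem_spanningFamily.mp hR'
    rw [Set.singleton_subset_iff] at hsU₁ hmU₂
    have hmU₁ : m ∉ U₁ := fun hm =>
      hxU₁ (hL U₁ (Set.pair_subset hsU₁ hm) hU₁ hx)
    have htU₂ : t ∉ U₂ := fun ht =>
      hyU₂ (hR U₂ (Set.pair_subset hmU₂ ht) hU₂ hy)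
    -- `U₁` separates `s` from `m` and `U₂` separates `m` from `t`. The complement of `U₂` contains
    -- `t` but not `m`, so it glues with `U₁` to a cut that contains both terminals and misses `m`.
    obtain ⟨U, hU, hE, hF⟩ := exists_glue hU₁ hU₂.compl fun x hx hx' => by
      simp [h x hx hx', hmU₁, hmU₂]
    have := hT U (Set.pair_subset ((hE s hs).mpr hsU₁) ((hF t ht).mpr htU₂)) hU
      (endVertices_sumElim.ge (Or.inl hm))
    exact hmU₁ ((hE m hm).mp this)
  · rintro (⟨hL, hR⟩ | ⟨hL, hR⟩) U hsU hU
    all_goals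
      rw [noEdgeLeaves_sumElim] at hU
      rw [endVertices_sumElim]
      have hs' : s ∈ U := hsU (by simp)
      have ht' : t ∈ U := hsU (by simp)
    · have h1 := hL U (Set.singleton_subset_iff.mpr hs') hU.1
      exact Set.union_subset h1 (hR U (Set.pair_subset (h1 hm) ht') hU.2)
    -- `F` is spanned from `m`; if `m` were outside `U`, the complementary cut would contain all of
    -- `F`, including `t`.
    · have hmU : m ∈ U := by
        by_contra hmU
        exact hR Uᶜ (Set.singleton_subset_iff.mpr hmU) hU.2.compl ht ht'
      have h2 : endVertices F ⊆ U := hR U (Set.singleton_subset_iff.mpr hmU) hU.2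
      exact Set.union_subset (hL U (Set.pair_subset hs' (h2 hm')) hU.1) h2

theorem spanningFamily_parallel_pair (hs : s ∈ endVertices E) (ht : t ∈ endVertices E)
    (hs' : s ∈ endVertices F) (ht' : t ∈ endVertices F)
    (h : ∀ x ∈ endVertices E, x ∈ endVertices F → x = s ∨ x = t) :
    spanningFamily (Sum.elim E F) {s, t} =
      unionFamily (spanningFamily E {s, t}) (spanningFamily F {s, t}) := by
  ext T
  constructor
  · exact fun hT => ⟨toLeft_mem_spanningFamily hT (by simp [hs', ht']) (by simpa using h),
      toRight_mem_spanningFamily hT (by simp [hs, ht]) (by simpa using h)⟩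
  · rintro ⟨hL, hR⟩ U hsU hU
    rw [noEdgeLeaves_sumElim] at hU
    rw [endVertices_sumElim]
    exact Set.union_subset (hL U hsU hU.1) (hR U hsU hU.2)

/-- The terminals must be joined within `E` or within `F`: otherwise cuts separating `s` from `t` on
both sides agree on the common vertices and glue. -/
theorem spanningFamily_parallel (hs : s ∈ endVertices E) (ht : t ∈ endVertices E)
    (hs' : s ∈ endVertices F) (ht' : t ∈ endVertices F)
    (h : ∀ x ∈ endVertices E, x ∈ endVertices F → x = s ∨ x = t) :
    spanningFamily (Sum.elim E F) {s} =
      crossFamily (spanningFamily E {s}) (spanningFamily E {s, t}) (spanningFamily F {s})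
        (spanningFamily F {s, t}) := by
  ext T
  constructor
  · intro hT
    have hD := spanningFamily_parallel_pair hs ht hs' ht' h ▸
      spanningFamily_mono _ (Set.singleton_subset_iff.mpr (Set.mem_insert s {t})) hT
    by_contra hn
    have hL' : T.toLeft ∉ spanningFamily E {s} := fun hL' => hn (Or.inl ⟨hL', hD.2⟩)
    have hR' : T.toRight ∉ spanningFamily F {s} := fun hR' => hn (Or.inr ⟨hD.1, hR'⟩)
    obtain ⟨U₁, hsU₁, hU₁, x, hx, hxU₁⟩ := notMem_spanningFamily.mp hL'
    obtain ⟨U₂, hsU₂, hU₂, y, hy, hyU₂⟩ := notMem_spanningFamily.mp hR'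
    rw [Set.singleton_subset_iff] at hsU₁ hsU₂
    have htU₁ : t ∉ U₁ := fun ht =>
      hxU₁ (hD.1 U₁ (Set.pair_subset hsU₁ ht) hU₁ hx)
    have htU₂ : t ∉ U₂ := fun ht =>
      hyU₂ (hD.2 U₂ (Set.pair_subset hsU₂ ht) hU₂ hy)
    obtain ⟨U, hU, hE, hF⟩ := exists_glue hU₁ hU₂ fun x hx hx' => by
      rcases h x hx hx' with rfl | rfl <;> simp [*]
    have := hT U (Set.singleton_subset_iff.mpr ((hE s hs).mpr hsU₁)) hU
      (endVertices_sumElim.ge (Or.inl ht))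
    exact htU₁ ((hE t ht).mp this)
  · rintro (⟨hL, hR⟩ | ⟨hL, hR⟩) U hsU hU
    all_goals
      rw [noEdgeLeaves_sumElim] at hU
      rw [endVertices_sumElim]
    · have h1 := hL U hsU hU.1
      exact Set.union_subset h1 (hR U (Set.pair_subset (h1 hs) (h1 ht)) hU.2)
    · have h2 := hR U hsU hU.2
      exact Set.union_subset (hL U (Set.pair_subset (h2 hs') (h2 ht')) hU.1) h2

end Network

/-! ### The inductive invariant of series-parallel networks -/

section TateNetwork

variable {K : Type u} [Field K] {ι κ : Type u}

/-- The properties of a network with terminals `s` and `t` that are stable under series and parallel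
composition. -/
structure IsTateNetwork (K : Type u) [Field K] {ι : Type u} [Fintype ι] (E : ι → MelonicEdge)
    (s t : ℕ) : Prop where
  source_mem : s ∈ endVertices E
  target_mem : t ∈ endVertices E
  strict : IsStrictPair (spanningFamily E {s}) (spanningFamily E {s, t})
  tate : IsTatePair (minimalPoly K (spanningFamily E {s, t})) (minimalPoly K (spanningFamily E {s}))
    (Fintype.card ι)
  scales : Scales 1 (minimalPoly K (spanningFamily E {s, t}))
    (minimalPoly K (spanningFamily E {s}))

variable {E : ι → MelonicEdge} {F : κ → MelonicEdge} {s m t : ℕ}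

theorem IsTateNetwork.series [Fintype ι] [Fintype κ] (hE : IsTateNetwork K E s m)
    (hF : IsTateNetwork K F m t)
    (h : ∀ x ∈ endVertices E, x ∈ endVertices F → x = m) :
    IsTateNetwork K (Sum.elim E F) s t := by
  have e1 := spanningFamily_series hE.source_mem hE.target_mem h
  have e2 := spanningFamily_series_pair hE.source_mem hE.target_mem hF.source_mem hF.target_mem h
  refine ⟨endVertices_sumElim.ge (Or.inl hE.source_mem),
    endVertices_sumElim.ge (Or.inr hF.target_mem), ?_, ?_, ?_⟩
  · rw [e1, e2]
    exact hE.strict.series hF.strict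
  · rw [e1, e2, minimalPoly_unionFamily, minimalPoly_crossFamily hE.strict hF.strict,
      Fintype.card_sum]
    exact hE.tate.cross hE.scales hF.scales hF.tate
  · rw [e1, e2, minimalPoly_unionFamily, minimalPoly_crossFamily hE.strict hF.strict]
    exact hE.scales.cross hF.scales

theorem IsTateNetwork.parallel [Fintype ι] [Fintype κ] (hE : IsTateNetwork K E s t)
    (hF : IsTateNetwork K F s t)
    (h : ∀ x ∈ endVertices E, x ∈ endVertices F → x = s ∨ x = t) :
    IsTateNetwork K (Sum.elim E F) s t := by
  have e1 := spanningFamily_parallel hE.source_mem hE.target_mem hF.source_mem hF.target_mem h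
  have e2 := spanningFamily_parallel_pair hE.source_mem hE.target_mem hF.source_mem hF.target_mem h
  refine ⟨endVertices_sumElim.ge (Or.inl hE.source_mem),
    endVertices_sumElim.ge (Or.inl hE.target_mem), ?_, ?_, ?_⟩
  · rw [e1, e2]
    exact hE.strict.parallel hF.strict
  · rw [e1, e2, minimalPoly_unionFamily, minimalPoly_crossFamily hE.strict hF.strict,
      crossSum_swap, Fintype.card_sum]
    -- In parallel `Φ` is the product and `Ψ` the cross sum. The series rule is applied to the
    -- exchanged pairs, with scaling exponent `-1`, and the result is exchanged back.
    exact (hE.tate.swap.cross hE.scales.swap hF.scales.swap hF.tate.swap).swap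
  · rw [e1, e2, minimalPoly_unionFamily, minimalPoly_crossFamily hE.strict hF.strict,
      crossSum_swap]
    simpa using (hE.scales.swap.cross hF.scales.swap).swap

theorem mem_spanningFamily_reindex (e : ι ≃ κ) (A : Set ℕ) (T : Finset ι) :
    T ∈ spanningFamily (F ∘ e) A ↔ T.map e.toEmbedding ∈ spanningFamily F A := by
  have h1 : endVertices (F ∘ e) = endVertices F := by
    ext x
    simp [endVertices, e.exists_congr_left]
  simp only [spanningFamily, NoEdgeLeaves, h1, Set.mem_ofPred_eq, Finset.forall_mem_map]
  rfl

theorem IsTateNetwork.reindex [Fintype ι] [Fintype κ] (e : ι ≃ κ)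
    (h : IsTateNetwork K F s t) :
    IsTateNetwork K (F ∘ e) s t := by
  have h1 : endVertices (F ∘ e) = endVertices F := by
    ext x
    simp [endVertices, e.exists_congr_left]
  refine ⟨h1 ▸ h.source_mem, h1 ▸ h.target_mem, h.strict.reindex e
    (mem_spanningFamily_reindex e _) (mem_spanningFamily_reindex e _), ?_, ?_⟩
  · rw [minimalPoly_reindex e (mem_spanningFamily_reindex e _),
      minimalPoly_reindex e (mem_spanningFamily_reindex e _), Fintype.card_congr e]
    exact h.tate.reindex e.symm
  · rw [minimalPoly_reindex e (mem_spanningFamily_reindex e _),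
      minimalPoly_reindex e (mem_spanningFamily_reindex e _)]
    exact h.scales.reindex e.symm

/-- With two roots the empty set already spans, so `Φ` is the variable; with one root the edge is
needed, so `Ψ = 1`. -/
theorem isTateNetwork_edge (e : MelonicEdge) (he : e.source ≠ e.target) :
    IsTateNetwork K (fun _ : PUnit.{u + 1} => e) e.source e.target := by
  have hV : endVertices (fun _ : PUnit.{u + 1} => e) = {e.source, e.target} := by
    ext x
    simp [endVertices]
  have h1 : spanningFamily (fun _ : PUnit.{u + 1} => e) {e.source, e.target} = Set.univ :=
    Set.eq_univ_of_forall fun T U hU _ => hV ▸ hU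
  have h2 : spanningFamily (fun _ : PUnit.{u + 1} => e) {e.source} = {Finset.univ} := by
    ext T
    rw [Set.mem_singleton_iff]
    constructor
    · intro hT
      by_contra hn
      have : T = ∅ := by
        by_contra hne
        obtain ⟨i, hi⟩ := Finset.nonempty_iff_ne_empty.mpr hne
        exact hn (Finset.eq_univ_of_forall fun j => Subsingleton.elim i j ▸ hi)
      have := hT {e.source} subset_rfl (fun i hi => by simp [this] at hi)
      rw [hV] at this
      exact he (this (by simp)).symm
    · rintro rfl U hU h
      have := h PUnit.unit (Finset.mem_univ _)
      rw [Set.singleton_subset_iff] at hU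
      exact hV ▸ Set.pair_subset hU (this.mp hU)
  have h3 : minimalPoly K (Set.univ : Set (Finset PUnit.{u + 1})) =
      MvPolynomial.X PUnit.unit := by
    rw [minimalPoly_eq_prod (S := ∅) (S' := Finset.univ) (fun T => ⟨fun h => ?_, ?_⟩) (by simp)]
    · simp
    · simpa using h.2 (y := ∅) trivial (by simp)
    · rintro rfl
      exact ⟨trivial, fun _ _ _ => by simp⟩
  have h4 : minimalPoly K ({Finset.univ} : Set (Finset PUnit.{u + 1})) = 1 := by
    rw [minimalPoly_eq_prod (C := {Finset.univ}) (S := Finset.univ) (S' := ∅)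
      (fun T => ⟨fun h => h.1, ?_⟩) (by simp), Finset.prod_empty]
    rintro rfl
    exact ⟨rfl, fun S hS _ => hS ▸ subset_rfl⟩
  refine ⟨hV ▸ by simp, hV ▸ by simp, ?_, ?_, ?_⟩
  · rw [h1, h2]
    refine ⟨Set.subset_univ _, ?_⟩
    rintro T rfl
    exact ⟨∅, trivial, by simp⟩
  · rw [h1, h2, h3, h4]
    exact isTatePair_X_one
  · rw [h1, h2, h3, h4]
    exact scales_X_one

end TateNetwork

/-! ### Series-parallel networks given by lists of edges -/

section ListNetwork

/-- The ends of the edges in a list. -/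
def listVertices (E : List MelonicEdge) : Set ℕ := {x | ∃ e ∈ E, x = e.source ∨ x = e.target}

/-- `E` is the list of edges of a series-parallel network with terminals `s` and `t`. -/
inductive IsNetwork : ℕ → ℕ → List MelonicEdge → Prop
  | edge (e : MelonicEdge) (he : e.source ≠ e.target) : IsNetwork e.source e.target [e]
  | series {s m t : ℕ} {E F : List MelonicEdge} (hE : IsNetwork s m E) (hF : IsNetwork m t F)
      (h : ∀ x ∈ listVertices E, x ∈ listVertices F → x = m) : IsNetwork s t (E ++ F)
  | parallel {s t : ℕ} {E F : List MelonicEdge} (hE : IsNetwork s t E) (hF : IsNetwork s t F)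
      (h : ∀ x ∈ listVertices E, x ∈ listVertices F → x = s ∨ x = t) : IsNetwork s t (E ++ F)

/-- The family of the edges in a list. -/
def edgeFamily (E : List MelonicEdge) (i : ULift.{u} (Fin E.length)) : MelonicEdge := E.get i.down

theorem endVertices_edgeFamily (E : List MelonicEdge) :
    endVertices (edgeFamily.{u} E) = listVertices E := by
  ext x
  simp [endVertices, listVertices, edgeFamily, List.mem_iff_get]

theorem exists_edgeFamily_append (E F : List MelonicEdge) :
    ∃ e : ULift.{u} (Fin (E ++ F).length) ≃
        ULift.{u} (Fin E.length) ⊕ ULift.{u} (Fin F.length),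
      edgeFamily (E ++ F) = Sum.elim (edgeFamily E) (edgeFamily F) ∘ e := by
  refine ⟨Equiv.ulift.trans ((finCongr List.length_append).trans (finSumFinEquiv.symm.trans
    (Equiv.sumCongr Equiv.ulift.symm Equiv.ulift.symm))), ?_⟩
  rw [← Equiv.comp_symm_eq]
  funext i
  rcases i with ⟨i⟩ | ⟨i⟩ <;> simp [edgeFamily]

theorem IsNetwork.isTateNetwork (K : Type u) [Field K] {s t : ℕ} {E : List MelonicEdge}
    (h : IsNetwork s t E) : IsTateNetwork K (edgeFamily E) s t := by
  induction h with
  | edge e he =>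
    have h : edgeFamily [e] =
        (fun _ : PUnit => e) ∘ Equiv.ulift.trans (Equiv.ofUnique (Fin 1) PUnit) := by
      funext i
      exact List.mem_singleton.mp (List.get_mem [e] i.down)
    rw [h]
    exact (isTateNetwork_edge (K := K) e he).reindex _
  | series _ _ h hE hF =>
    obtain ⟨e, he⟩ := exists_edgeFamily_append _ _
    rw [he]
    exact (hE.series hF (by simpa only [endVertices_edgeFamily] using h)).reindex e
  | parallel _ _ h hE hF =>
    obtain ⟨e, he⟩ := exists_edgeFamily_append _ _
    rw [he]
    exact (hE.parallel hF (by simpa only [endVertices_edgeFamily] using h)).reindex e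

end ListNetwork

/-! ### Melonic constructions give series-parallel networks -/

section Melonic

theorem mem_listVertices_append {E F : List MelonicEdge} {x : ℕ} :
    x ∈ listVertices (E ++ F) ↔ x ∈ listVertices E ∨ x ∈ listVertices F := by
  simp [listVertices, or_and_right, exists_or]

theorem mem_listVertices_replicate {a x : ℕ} {e : MelonicEdge}
    (h : x ∈ listVertices (List.replicate a e)) : x = e.source ∨ x = e.target := by
  obtain ⟨e', he', hx⟩ := h
  rwa [List.eq_of_mem_replicate he'] at hx

theorem isNetwork_replicate {a : ℕ} (ha : 0 < a) (e : MelonicEdge) (he : e.source ≠ e.target) :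
    IsNetwork e.source e.target (List.replicate a e) := by
  induction a, ha using Nat.le_induction with
  | base => exact .edge e he
  | succ a _ ih =>
    exact .parallel (.edge e he) ih fun x _ hx => mem_listVertices_replicate hx

/-- Each banana is a parallel bundle, and the string is their series composition. The range of the
inner vertices shows that the first banana meets the rest only at `m`, and later that the new
vertices are fresh. -/
theorem isNetwork_bananaString (s w u m j : ℕ) (l : List ℕ) (hl : l ≠ []) (hpos : ∀ a ∈ l, 0 < a)
    (huw : u ≠ w) (hu : u < m) (hw : w < m) :
    IsNetwork u w (bananaString s w u m j l) ∧ ∀ x ∈ listVertices (bananaString s w u m j l),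
      x = u ∨ x = w ∨ m ≤ x ∧ x < m + (l.length - 1) := by
  induction l generalizing u m j with
  | nil => exact absurd rfl hl
  | cons a l ih =>
    cases l with
    | nil =>
      refine ⟨isNetwork_replicate (hpos a (by simp)) ⟨u, w, s, j⟩ huw, fun x hx => ?_⟩
      have := mem_listVertices_replicate hx
      tauto
    | cons b l =>
      have h1 : IsNetwork u m (List.replicate a ⟨u, m, s, j⟩) :=
        isNetwork_replicate (hpos a (by simp)) ⟨u, m, s, j⟩ hu.ne
      obtain ⟨h2, h3⟩ := ih m (m + 1) (j + 1) (by simp) (fun a ha => hpos a (by simp [ha])) hw.ne'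
        (by omega) (by omega)
      refine ⟨.series h1 h2 fun x hx hx' => ?_, fun x hx => ?_⟩
      · have hx1 : x = u ∨ x = m := mem_listVertices_replicate hx
        have hx2 := h3 x hx'
        omega
      · rcases mem_listVertices_append.mp hx with hx | hx
        · have hx1 : x = u ∨ x = m := mem_listVertices_replicate hx
          simp only [List.length_cons]
          omega
        · have hx2 := h3 x hx
          simp only [List.length_cons] at hx2 ⊢
          omega

variable {p k : ℕ} {f : MelonicEdge → List MelonicEdge}

/-- At most one edge is replaced, so at least one of the two parts stays as it is. -/
theorem replaceEdge_append (E F : List MelonicEdge) :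
    replaceEdge p k f (E ++ F) = replaceEdge p k f E ++ F ∨
      replaceEdge p k f (E ++ F) = E ++ replaceEdge p k f F := by
  induction E with
  | nil => exact Or.inr rfl
  | cons e E ih =>
    simp only [List.cons_append, replaceEdge]
    split_ifs
    · exact Or.inl (List.append_assoc _ _ _).symm
    · simpa using ih

theorem exists_of_mem_replaceEdge {E : List MelonicEdge} {e : MelonicEdge}
    (h : e ∈ replaceEdge p k f E) : e ∈ E ∨ ∃ e' ∈ E, e ∈ f e' := by
  induction E with
  | nil => exact Or.inl h
  | cons e' E ih =>
    rw [replaceEdge] at h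
    split_ifs at h
    · rcases List.mem_append.mp h with h | h
      · exact Or.inr ⟨e', by simp, h⟩
      · exact Or.inl (by simp [h])
    · rcases List.mem_cons.mp h with rfl | h
      · exact Or.inl (by simp)
      · rcases ih h with h | ⟨e'', h, h'⟩
        · exact Or.inl (by simp [h])
        · exact Or.inr ⟨e'', by simp [h], h'⟩

theorem IsNetwork.source_ne_target {s t : ℕ} {E : List MelonicEdge} (h : IsNetwork s t E) :
    ∀ e ∈ E, e.source ≠ e.target := by
  induction h with
  | edge e he => simpa using he
  | series _ _ _ hE hF => exact fun e he => (List.mem_append.mp he).elim (hE e) (hF e)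
  | parallel _ _ _ hE hF => exact fun e he => (List.mem_append.mp he).elim (hE e) (hF e)

theorem mem_listVertices_replaceEdge {E : List MelonicEdge} {m n : ℕ}
    (hf : ∀ e ∈ E, ∀ x ∈ listVertices (f e), x = e.source ∨ x = e.target ∨ m ≤ x ∧ x < n) {x : ℕ}
    (hx : x ∈ listVertices (replaceEdge p k f E)) : x ∈ listVertices E ∨ m ≤ x ∧ x < n := by
  obtain ⟨e, he, hx⟩ := hx
  rcases exists_of_mem_replaceEdge he with he | ⟨e', he', h⟩
  · exact Or.inl ⟨e, he, hx⟩
  · have := hf e' he' x ⟨e, h, hx⟩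
    rw [← or_assoc] at this
    exact this.imp_left fun h => ⟨e', he', h⟩

/-- A network substituted for an edge replaces a leaf of the series-parallel decomposition. The new
vertices are at least `m`, so the changed part meets the other part only in old vertices. -/
theorem IsNetwork.replaceEdge {s t : ℕ} {E : List MelonicEdge} (h : IsNetwork s t E) {m n : ℕ}
    (hE : ∀ x ∈ listVertices E, x < m) (hf : ∀ e ∈ E, IsNetwork e.source e.target (f e))
    (hf' : ∀ e ∈ E, ∀ x ∈ listVertices (f e), x = e.source ∨ x = e.target ∨ m ≤ x ∧ x < n) :
    IsNetwork s t (replaceEdge p k f E) := by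
  induction h with
  | edge e he =>
    rw [_root_.replaceEdge]
    split_ifs
    · simpa using hf e (by simp)
    · exact .edge e he
  | @series s c t E F h1 h2 h3 ih1 ih2 =>
    simp only [mem_listVertices_append, List.mem_append] at hE hf hf'
    rcases replaceEdge_append (p := p) (k := k) (f := f) E F with h | h <;> rw [h]
    · refine .series (ih1 (fun x hx => hE x (Or.inl hx)) (fun e he => hf e (Or.inl he))
        fun e he => hf' e (Or.inl he)) h2 fun x hx hx' => ?_
      rcases mem_listVertices_replaceEdge (fun e he => hf' e (Or.inl he)) hx with hx | hx
      · exact h3 x hx hx'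
      · exact absurd (hE x (Or.inr hx')) (by omega)
    · refine .series h1 (ih2 (fun x hx => hE x (Or.inr hx)) (fun e he => hf e (Or.inr he))
        fun e he => hf' e (Or.inr he)) fun x hx hx' => ?_
      rcases mem_listVertices_replaceEdge (fun e he => hf' e (Or.inr he)) hx' with hx' | hx'
      · exact h3 x hx hx'
      · exact absurd (hE x (Or.inl hx)) (by omega)
  | @parallel s t E F h1 h2 h3 ih1 ih2 =>
    simp only [mem_listVertices_append, List.mem_append] at hE hf hf'
    rcases replaceEdge_append (p := p) (k := k) (f := f) E F with h | h <;> rw [h]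
    · refine .parallel (ih1 (fun x hx => hE x (Or.inl hx)) (fun e he => hf e (Or.inl he))
        fun e he => hf' e (Or.inl he)) h2 fun x hx hx' => ?_
      rcases mem_listVertices_replaceEdge (fun e he => hf' e (Or.inl he)) hx with hx | hx
      · exact h3 x hx hx'
      · exact absurd (hE x (Or.inr hx')) (by omega)
    · refine .parallel h1 (ih2 (fun x hx => hE x (Or.inr hx)) (fun e he => hf e (Or.inr he))
        fun e he => hf' e (Or.inr he)) fun x hx hx' => ?_
      rcases mem_listVertices_replaceEdge (fun e he => hf' e (Or.inr he)) hx' with hx' | hx'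
      · exact h3 x hx hx'
      · exact absurd (hE x (Or.inl hx)) (by omega)

/-- The invariant is that all vertices are below `m`; each stage raises `m` by the number of inner
vertices that it creates. -/
theorem isNetwork_runMelonic (T : List MelonicStage) (hnil : ∀ t ∈ T, t.bananas ≠ [])
    (hpos : ∀ t ∈ T, ∀ a ∈ t.bananas, 0 < a) (s m x y : ℕ) (E : List MelonicEdge)
    (hE : IsNetwork x y E) (hm : ∀ z ∈ listVertices E, z < m) :
    IsNetwork x y (runMelonic s m T E) := by
  induction T generalizing s m E with
  | nil => exact hE
  | cons t T ih =>
    have key : ∀ e ∈ E, _ := fun e he => isNetwork_bananaString s e.target e.source m 1 t.bananas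
      (hnil t (by simp)) (hpos t (by simp)) (hE.source_ne_target e he)
      (hm _ ⟨e, he, Or.inl rfl⟩) (hm _ ⟨e, he, Or.inr rfl⟩)
    refine ih (fun t ht => hnil t (by simp [ht])) (fun t ht => hpos t (by simp [ht])) _ _ _
      (hE.replaceEdge hm (fun e he => (key e he).1) fun e he => (key e he).2) fun z hz => ?_
    rcases mem_listVertices_replaceEdge (fun e he => (key e he).2) hz with hz | hz
    · exact (hm z hz).trans_le (Nat.le_add_right _ _)
    · exact hz.2

theorem IsMelonicConstruction.isNetwork {T : List MelonicStage} (hT : IsMelonicConstruction T) :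
    IsNetwork 0 1 (melonicEdges T) := by
  refine isNetwork_runMelonic T hT.bananas_ne_nil hT.bananas_pos 1 2 0 1 _
    (.edge ⟨0, 1, 0, 1⟩ Nat.zero_ne_one) ?_
  rintro z ⟨e, he, hz⟩
  rw [List.mem_singleton.mp he] at hz
  simp only at hz
  omega

end Melonic

/-! ### Spanning trees of melonic graphs -/

namespace Graph

section SpanningTree

variable {α : Type v} {β : Type u} {G : Graph α β}

theorem JoinedBy.mono {F F' : Set β} (h : F ⊆ F') {x y : α} (hxy : G.JoinedBy F x y) :
    G.JoinedBy F' x y :=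
  Relation.ReflTransGen.mono (fun _ _ ⟨e, he, hl⟩ => ⟨e, h he, hl⟩) _ _ hxy

theorem JoinedBy.symm {F : Set β} {x y : α} (h : G.JoinedBy F x y) : G.JoinedBy F y x := by
  induction h with
  | refl => exact .refl
  | tail _ h ih =>
    obtain ⟨e, he, hl⟩ := h
    exact .head ⟨e, he, hl.symm⟩ ih

/-- The edges in a finite set of edges of a graph. -/
def edgesOf (G : Graph α β) (T : Finset G.edgeSet) : Set β :=
  {e | ∃ h : e ∈ G.edgeSet, (⟨e, h⟩ : G.edgeSet) ∈ T}

/-- The finite sets of edges that join all the vertices. -/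
def connectingFamily (G : Graph α β) : Set (Finset G.edgeSet) :=
  {T | ∀ x ∈ G.vertexSet, ∀ y ∈ G.vertexSet, G.JoinedBy (G.edgesOf T) x y}

/-- An edge whose ends are joined by the other edges can be dropped without losing connectivity, so
acyclicity of a connecting set is its minimality. -/
theorem isSpanningTree_edgesOf_iff (hG : G.vertexSet.Nonempty) (T : Finset G.edgeSet) :
    G.IsSpanningTree (G.edgesOf T) ↔ Minimal (· ∈ G.connectingFamily) T := by
  classical
  constructor
  · rintro ⟨-, -, hc, ha⟩
    refine ⟨hc, fun S hS hST e he => ?_⟩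
    by_contra heS
    obtain ⟨x, y, hxy⟩ := G.edge_mem_iff_exists_isLink e |>.mp e.2
    refine ha e ⟨e.2, he⟩ x y hxy ((hS x hxy.left_mem y hxy.right_mem).mono ?_)
    rintro e' ⟨he', heS'⟩
    refine ⟨⟨he', hST heS'⟩, ?_⟩
    rintro rfl
    exact heS heS'
  · rintro ⟨hc, hm⟩
    refine ⟨fun e he => he.1, hG, hc, ?_⟩
    rintro e ⟨he, heT⟩ x y hxy hj
    have hsub : G.edgesOf T \ {e} ⊆ G.edgesOf (T.erase ⟨e, he⟩) := by
      rintro e' ⟨⟨he', heT'⟩, hne⟩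
      exact ⟨he', Finset.mem_erase.mpr ⟨fun h => hne (congrArg Subtype.val h), heT'⟩⟩
    have hS : T.erase ⟨e, he⟩ ∈ G.connectingFamily := by
      intro a ha b hb
      have hab := hc a ha b hb
      induction hab with
      | refl => exact .refl
      | @tail c d _ hcd ih =>
        obtain ⟨e', he', hl⟩ := hcd
        refine (ih hl.left_mem).trans ?_
        by_cases hee : e' = e
        · subst hee
          rcases hxy.eq_and_eq_or_eq_and_eq hl with ⟨rfl, rfl⟩ | ⟨rfl, rfl⟩
          · exact hj.mono hsub
          · exact hj.symm.mono hsub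
        · exact .single ⟨e', hsub ⟨he', hee⟩, hl⟩
    exact Finset.notMem_erase _ _ (hm hS (Finset.erase_subset _ _) heT)

theorem kirchhoff_eq_minimalPoly (K : Type u) [Field K] [Fintype G.edgeSet]
    (hG : G.vertexSet.Nonempty) : G.kirchhoff K = minimalPoly K G.connectingFamily := by
  classical
  rw [kirchhoff, minimalPoly]
  refine Finset.sum_congr (Finset.ext fun T => ?_) fun T _ => Finset.prod_congr ?_ fun _ _ => rfl
  · rw [Finset.mem_filter_univ, Finset.mem_filter_univ]
    exact isSpanningTree_edgesOf_iff hG T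
  · ext e
    simp

/-- A description of a graph by the list of the ends of its edges. -/
theorem connectingFamily_eq_spanningFamily (f : G.vertexSet → ℕ) (hf : Function.Injective f)
    (E : G.edgeSet → MelonicEdge)
    (hE : ∀ (e : G.edgeSet) (x y : G.vertexSet),
      G.IsLink e x y ↔ s((E e).source, (E e).target) = s(f x, f y))
    (hV : endVertices E = Set.range f) {s : ℕ} (hs : s ∈ endVertices E) :
    G.connectingFamily = spanningFamily E {s} := by
  rw [hV] at hs
  obtain ⟨v, rfl⟩ := hs
  ext T
  constructor
  · intro hT U hvU hU
    rw [hV]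
    rintro _ ⟨x, rfl⟩
    -- A path from `v` cannot leave `U`. Membership in the vertex set is carried along because `f`
    -- is defined only there.
    have key : ∀ y : α, G.JoinedBy (G.edgesOf T) v y → ∃ hy : y ∈ G.vertexSet, f ⟨y, hy⟩ ∈ U := by
      intro y hy
      induction hy with
      | refl => exact ⟨v.2, hvU rfl⟩
      | @tail c d _ hcd ih =>
        obtain ⟨e, ⟨he, heT⟩, hl⟩ := hcd
        obtain ⟨hc, hcU⟩ := ih
        refine ⟨hl.right_mem, ?_⟩
        have h1 := (hE ⟨e, he⟩ ⟨c, hc⟩ ⟨d, hl.right_mem⟩).mp hl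
        have h2 := hU _ heT
        rcases Sym2.eq_iff.mp h1 with ⟨h3, h4⟩ | ⟨h3, h4⟩
        · rwa [h3, h4, iff_true_left hcU] at h2
        · rwa [h3, h4, iff_true_right hcU] at h2
    exact (key x (hT v v.2 x x.2)).2
  · intro hT
    have key : ∀ x : G.vertexSet, G.JoinedBy (G.edgesOf T) v x := by
      -- The test cut consists of the labels of the vertices joined to `v`.
      have h := hT {n | ∃ x : G.vertexSet, f x = n ∧ G.JoinedBy (G.edgesOf T) v x}
        (Set.singleton_subset_iff.mpr ⟨v, rfl, .refl⟩) ?_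
      · intro x
        obtain ⟨y, hy, hj⟩ := h (hV ▸ ⟨x, rfl⟩ : f x ∈ endVertices E)
        rwa [hf hy] at hj
      · intro e he
        obtain ⟨a, ha⟩ : (E e).source ∈ Set.range f := hV ▸ source_mem_endVertices E e
        obtain ⟨b, hb⟩ : (E e).target ∈ Set.range f := hV ▸ target_mem_endVertices E e
        have hl : G.IsLink e a b := (hE e a b).mpr (by rw [ha, hb])
        have he' : (e : β) ∈ G.edgesOf T := ⟨e.2, he⟩
        constructor
        · rintro ⟨x, hx, hj⟩
          rw [← ha] at hx
          exact ⟨b, hb, hf hx ▸ hj |>.tail ⟨e, he', hl⟩⟩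
        · rintro ⟨x, hx, hj⟩
          rw [← hb] at hx
          exact ⟨a, ha, hf hx ▸ hj |>.tail ⟨e, he', hl.symm⟩⟩
    exact fun x hx y hy => (key ⟨x, hx⟩).symm.trans (key ⟨y, hy⟩)

end SpanningTree

theorem IsMelonic.exists_isTateNetwork {α : Type v} {β : Type u} {G : Graph α β}
    [Fintype G.edgeSet] (hG : G.IsMelonic) (K : Type u) [Field K] :
    ∃ (E : G.edgeSet → MelonicEdge) (s t : ℕ), IsTateNetwork K E s t ∧
      G.kirchhoff K = minimalPoly K (spanningFamily E {s}) := by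
  obtain ⟨T, hT, hiso⟩ := hG
  have hN := hT.isNetwork.isTateNetwork K
  generalize melonicEdges T = L at hN hiso
  obtain ⟨f, g, hfg⟩ := hiso
  have hmem : ∀ i : Fin L.length, i ∈ (graphOfEdges L).edgeSet := fun i =>
    ((graphOfEdges L).edge_mem_iff_exists_isLink i).mpr ⟨L[i].source, L[i].target, rfl⟩
  let e : G.edgeSet ≃ ULift.{u} (Fin L.length) :=
    (g.trans (Equiv.subtypeUnivEquiv hmem)).trans Equiv.ulift.symm
  have hN' := hN.reindex e
  have hV : endVertices (edgeFamily.{u} L ∘ e) = Set.range fun x => (f x : ℕ) := by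
    have h1 : Set.range (fun x => (f x : ℕ)) = (graphOfEdges L).vertexSet := by
      ext n
      exact ⟨fun ⟨x, hx⟩ => hx ▸ (f x).2, fun hn => ⟨f.symm ⟨n, hn⟩, by simp⟩⟩
    have h2 : endVertices (edgeFamily.{u} L ∘ e) = endVertices (edgeFamily.{u} L) := by
      ext n
      simp [endVertices, e.exists_congr_left]
    rw [h1, h2, endVertices_edgeFamily]
    rfl
  refine ⟨_, 0, 1, hN', ?_⟩
  have h0 := hN'.source_mem
  have hne : G.vertexSet.Nonempty := by
    rw [hV] at h0
    obtain ⟨x, -⟩ := h0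
    exact ⟨x, x.2⟩
  rw [kirchhoff_eq_minimalPoly K hne, connectingFamily_eq_spanningFamily (fun x => (f x : ℕ))
    (fun x y h => f.injective (Subtype.ext h)) (edgeFamily.{u} L ∘ e)
    (fun i x y => hfg i x y) hV h0]

end Graph

/-! ### The classes of a melonic graph -/

theorem isTateClass_aeval {K : Type u} [Field K] (P : ℤ[X]) :
    IsTateClass (aeval (lefschetz K) P) := by
  rw [IsTateClass, aeval_eq_sum_range]
  exact sum_mem fun i _ =>
    zsmul_mem (pow_mem (Subring.mem_closure_of_mem (Set.mem_singleton _)) i) _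

theorem mainTheorem10 {K : Type u} [Field K] {α : Type v} {β : Type u} (G : Graph α β)
    [Fintype G.edgeSet] (hG : G.IsMelonic) :
    (∃ P : ℤ[X], P.natDegree = Fintype.card G.edgeSet ∧
      G.grothendieckClass K = aeval (lefschetz K) P) ∧
    IsTateClass (G.grothendieckClass K) ∧
    IsTateClass (varietyClass (G.affineHypersurface K)) := by
  obtain ⟨E, s, t, hE, hK⟩ := hG.exists_isTateNetwork K
  obtain ⟨a, b, f, ha, -, hf, da, -, mf, df⟩ := hE.tate
  have h1 := hasClass_isUnit_right hE.scales ha hf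
  rw [← hK] at h1
  have hU : G.grothendieckClass K = aeval (lefschetz K) (a + (X - 1) * f) :=
    (hasClass_isUnit (G.kirchhoff K)).unique h1
  have hT : IsTateClass (G.grothendieckClass K) := hU ▸ isTateClass_aeval _
  refine ⟨⟨_, (monic_add_X_sub_one_mul da mf df).2, hU⟩, hT, ?_⟩
  -- The class of the cone is `𝕃ⁿ - 𝕌(G)`, by the scissor relation in affine space.
  have h := varietyClass_specVariety_eq_add (K := K) (G.kirchhoff K)
  rw [← varietyClass_openVariety_basicOpen, varietyClass_mvPolynomial, ← sub_eq_iff_eq_add] at h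
  have h' : varietyClass (G.affineHypersurface K) =
      lefschetz K ^ Fintype.card G.edgeSet - G.grothendieckClass K := h.symm
  rw [h']
  exact sub_mem (pow_mem (Subring.mem_closure_of_mem (Set.mem_singleton _)) _) hT
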